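/- \textbf{Setting.} Work in the Edinburgh Logical Framework LF (kinds, type families and objects over a valid signature $\Sigma$; definitional equality $\equiv$ is $\beta\eta$-conversion). A context is a list $\Gamma=x_1{:}A_1,\dots,x_n{:}A_n$, and $\Gamma'\vdash\sigma:\Gamma$ says that $\sigma$ is a well-typed substitution from $\Gamma$ to $\Gamma'$. Formulas of the logic M2 are $\forall\Gamma_1.\exists\Gamma_2.\top$ ($\Gamma_2$ may depend on $\Gamma_1$; empty quantifiers are omitted), and its sequents are $\Gamma;\Delta\vdash F$ with $\Gamma$ a valid context and $\Delta$ a finite collection of formulas, $\Delta$ and $F$ being given over $\Gamma$. Proof terms are left out. An \emph{M2 proof} is a derivation by the following rules. (The recursion rule of M2 is not needed: a proof without it is in particular a proof in all of M2.) \begin{itemize} \item $(\forall L)$ If $\forall\Gamma_1.F_1\in\Delta$ and $\Gamma\vdash\sigma:\Gamma_1$, infer $\Gamma;\Delta\vdash F$ from $\Gamma;\Delta,F_1[\sigma]\vdash F$. \item $(\exists L)$ If $\exists\Gamma_1.\top\in\Delta$, infer $\Gamma;\Delta\vdash F$ from $\Gamma,\Gamma_1;\Delta\vdash F$. \item $(\forall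 R)$ Infer $\Gamma;\Delta\vdash\forall\Gamma_1.F$ from $\Gamma,\Gamma_1;\Delta\vdash F$. \item $(\exists R)$ Infer $\Gamma;\Delta\vdash\exists\Gamma_1.\top$ if $\Gamma\vdash\sigma:\Gamma_1$ for some $\sigma$. \item (case) Let $\Gamma_1,x{:}A_x,\Gamma_2$ be a valid permutation of $\Gamma$ with $A_x$ atomic. Infer $\Gamma;\Delta\vdash F$ if for every object constant $c:\Pi\Gamma_c.A_c$ of $\Sigma$ ($A_c$ atomic) either the unification problem $(A_x=A_c,\ x=c\,\Gamma_c)$ has no unifier on $(\Gamma_1,x{:}A_x,\Gamma_c)$, or it has a most general unifier $\Gamma'\vdash\sigma:(\Gamma_1,x{:}A_x,\Gamma_c)$ for which $\Gamma',\Gamma_2[\sigma];\Delta[\sigma]\vdash F[\sigma]$ is derivable. (Unifiers are well-typed substitutions into arbitrary valid contexts.) \end{itemize} \textbf{Translation of a clause.} Let $a:\Pi\Gamma^I.\Pi\Gamma^O.\mathsf{type}$ be a type family with input parameters $\Gamma^I$ and output parameters $\Gamma^O$, and let $c:A\leftarrow A_1\leftarrow\cdots\leftarrow A_m$ be a clause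 for $a$, i.e. a constant of $\Sigma$ of type $\Pi\Gamma_v.\,A_m\to\cdots\to A_1\to A$ where $A$ and all $A_i$ are $a$ applied to inputs and outputs. Let $\sigma^I_c,\sigma^O_c$ be the substitutions given by the inputs and the outputs of $A$, and $\sigma^I_i$ the one given by the inputs of $A_i$. Let $\Gamma_{c_0}$ be the context of the variables of $\Gamma_v$ occurring in the inputs of $A$, and let $\Gamma_{c_i}$ extend $\Gamma_{c_{i-1}}$ by the remaining variables occurring in the outputs of $A_i$ and by $D_i:A_i$ (in each case together with the variables on which the types of these variables depend). Let $F_c=\exists\Gamma^O[\sigma^I_c].\exists D{:}a\,\sigma^I_c\,\Gamma^O.\top$, and write $S_{c_i}$ for a sequent $\Gamma_{c_i};\Delta_i\vdash F_c$. The translation generates proofs as follows. \begin{itemize} \item A proof of $S_{c_m}$ is an application of $(\exists R)$ with the witnesses $\sigma^O_c$ and $c\,\Gamma_v\,D_m\cdots D_1$. \item For $1\le i\le m$, a proof of $S_{c_{i-1}}$ ends with $(\forall L)$, applied to the induction hypothesis $\forall\Gamma^I.\exists\Gamma^O.\exists D{:}a\,\Gamma^I\,\Gamma^O.\top\in\Delta_{i-1}$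 and $\sigma^I_i$, preceded by $(\exists L)$ on the formula just obtained; this leaves a sequent with context $\Gamma_{c_{i-1}},\Gamma^O[\sigma^I_i],D_i{:}a\,\sigma^I_i\,\Gamma^O$. \item Output splitting is then applied any number of times: in a sequent with context $\Gamma_{c_{i-1}},\Theta$, the case rule is applied to a variable $x{:}A_x$ of $\Theta=\Theta_1,x{:}A_x,\Theta_2$ other than $D_i$, with $\Gamma_1=\Gamma_{c_{i-1}},\Theta_1$ and $\Gamma_2=\Theta_2$. For each constant $b:\Pi\Gamma_b.A_b$ of $\Sigma$, either $A_x$ is not an instance of $A_b$ and there is no unifier, or the most general unifier is $\sigma=(\mathrm{id}_{\Gamma_1},(b\,\Gamma_b)[\sigma']/x,\sigma')$ with $\Gamma'=\Gamma_1,\Gamma_b'$, where $\sigma'$ is a most general substitution with $A_x=A_b[\sigma']$. \item Each remaining sequent arises from $S_{c_i}$ by a bijective renaming which fixes the variables of $\Gamma_{c_{i-1}}$ and takes $D_i$ to $D_i$ (types being compared up to $\equiv$), and its proof is the corresponding renaming of the generated proof of $S_{c_i}$. \end{itemize} The \emph{input context} is $\Gamma_{c_i}$ for $S_{c_i}$ and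 also for the sequent after $(\forall L)$ that is reached from it, and it is $\Gamma_{c_{i-1}}$ for the sequents whose context is $\Gamma_{c_{i-1}},\Theta$ as above. \textbf{Theorem (Instantiation Theorem for M2).} Let $\Sigma$ be a valid LF signature, and let $\mathcal D$ be an M2 proof of a sequent $\Gamma_1,\Gamma_2;\Delta\vdash F$ which is generated from a clause as above (at any point of the translation), where $\Gamma_1$ is an initial part of the input context and $\Gamma_2$ is the rest of the context, which contains the output parameters. Then for every valid context $\Gamma_1'$ and every substitution $\Gamma_1'\vdash\sigma_1:\Gamma_1$, \[\Gamma_1',\Gamma_2[\sigma_1];\ \Delta[\sigma_1]\vdash F[\sigma_1]\] is a (valid) M2 sequent and it has an M2 proof. -/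

import Mathlib

/-! ## LF: expressions, substitution and conversion -/

namespace LF

/-- The three syntactic categories of LF. -/
inductive Lvl : Type
  | kind
  | fam
  | obj

/-- LF kinds, type families and objects, with de Bruijn indices for the object variables.
Constants are named by natural numbers. -/
inductive Exp : Lvl → Type
  | typ : Exp .kind
  | piK : Exp .fam → Exp .kind → Exp .kind
  | fcon : ℕ → Exp .fam
  | pi : Exp .fam → Exp .fam → Exp .fam
  | flam : Exp .fam → Exp .fam → Exp .fam
  | fapp : Exp .fam → Exp .obj → Exp .fam
  | con : ℕ → Exp .obj
  | var : ℕ → Exp .obj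
  | lam : Exp .fam → Exp .obj → Exp .obj
  | app : Exp .obj → Exp .obj → Exp .obj

abbrev Kind := Exp .kind
abbrev Fam := Exp .fam
abbrev Obj := Exp .obj

/-- A substitution maps every variable to an object. -/
abbrev Sub := ℕ → Obj

/-- Extension of a renaming under one binder. -/
def liftRen (r : ℕ → ℕ) : ℕ → ℕ
  | 0 => 0
  | n + 1 => r n + 1

def Exp.rename : {l : Lvl} → (ℕ → ℕ) → Exp l → Exp l
  | _, _, .typ => .typ
  | _, r, .piK A K => .piK (A.rename r) (K.rename (liftRen r))
  | _, _, .fcon a => .fcon a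
  | _, r, .pi A B => .pi (A.rename r) (B.rename (liftRen r))
  | _, r, .flam A B => .flam (A.rename r) (B.rename (liftRen r))
  | _, r, .fapp A M => .fapp (A.rename r) (M.rename r)
  | _, _, .con c => .con c
  | _, r, .var n => .var (r n)
  | _, r, .lam A M => .lam (A.rename r) (M.rename (liftRen r))
  | _, r, .app M N => .app (M.rename r) (N.rename r)

/-- Weakening by `k` variables. -/
def Exp.shift {l : Lvl} (k : ℕ) (e : Exp l) : Exp l := e.rename (fun n => n + k)

/-- Extension of a substitution under one binder. -/
def lift (s : Sub) : Sub
  | 0 => .var 0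
  | n + 1 => (s n).shift 1

/-- Extension of a substitution by the identity on `k` further variables. -/
def liftN : ℕ → Sub → Sub
  | 0, s => s
  | k + 1, s => lift (liftN k s)

/-- Capture-avoiding simultaneous substitution `e[s]`. -/
def Exp.subst : {l : Lvl} → Sub → Exp l → Exp l
  | _, _, .typ => .typ
  | _, s, .piK A K => .piK (A.subst s) (K.subst (lift s))
  | _, _, .fcon a => .fcon a
  | _, s, .pi A B => .pi (A.subst s) (B.subst (lift s))
  | _, s, .flam A B => .flam (A.subst s) (B.subst (lift s))
  | _, s, .fapp A M => .fapp (A.subst s) (M.subst s)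
  | _, _, .con c => .con c
  | _, s, .var n => s n
  | _, s, .lam A M => .lam (A.subst s) (M.subst (lift s))
  | _, s, .app M N => .app (M.subst s) (N.subst s)

/-- The substitution of the list `Ms = [M₁, …, Mₖ]` for the last `k` variables (`Mₖ` for the
variable with index `0`); it is the identity on all earlier variables. -/
def listSub (Ms : List Obj) : Sub :=
  fun n => Ms.reverse.getD n (.var (n - Ms.length))

/-- `e[M/x]` for the most recent variable `x`. -/
def Exp.inst {l : Lvl} (e : Exp l) (M : Obj) : Exp l := e.subst (listSub [M])

/-- One step of βη-reduction, anywhere in an expression. -/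
inductive Step : {l : Lvl} → Exp l → Exp l → Prop
  | beta (A : Fam) (M N : Obj) : Step (.app (.lam A M) N) (M.inst N)
  | fbeta (A B : Fam) (N : Obj) : Step (.fapp (.flam A B) N) (B.inst N)
  | eta (A : Fam) (M : Obj) : Step (.lam A (.app (M.shift 1) (.var 0))) M
  | feta (A B : Fam) : Step (.flam A (.fapp (B.shift 1) (.var 0))) B
  | piK₁ {A A' : Fam} (K : Kind) : Step A A' → Step (.piK A K) (.piK A' K)
  | piK₂ (A : Fam) {K K' : Kind} : Step K K' → Step (.piK A K) (.piK A K')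
  | pi₁ {A A' : Fam} (B : Fam) : Step A A' → Step (.pi A B) (.pi A' B)
  | pi₂ (A : Fam) {B B' : Fam} : Step B B' → Step (.pi A B) (.pi A B')
  | flam₁ {A A' : Fam} (B : Fam) : Step A A' → Step (.flam A B) (.flam A' B)
  | flam₂ (A : Fam) {B B' : Fam} : Step B B' → Step (.flam A B) (.flam A B')
  | fapp₁ {A A' : Fam} (M : Obj) : Step A A' → Step (.fapp A M) (.fapp A' M)
  | fapp₂ (A : Fam) {M M' : Obj} : Step M M' → Step (.fapp A M) (.fapp A M')
  | lam₁ {A A' : Fam} (M : Obj) : Step A A' → Step (.lam A M) (.lam A' M)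
  | lam₂ (A : Fam) {M M' : Obj} : Step M M' → Step (.lam A M) (.lam A M')
  | app₁ {M M' : Obj} (N : Obj) : Step M M' → Step (.app M N) (.app M' N)
  | app₂ (M : Obj) {N N' : Obj} : Step N N' → Step (.app M N) (.app M N')

/-- Definitional equality `≡`: βη-conversion. -/
def Conv {l : Lvl} : Exp l → Exp l → Prop := Relation.EqvGen Step

/-! ## LF: signatures, contexts and typing -/

/-- A declaration `a : K` or `c : A` of a signature. -/
inductive Decl : Type
  | fam : ℕ → Kind → Decl
  | obj : ℕ → Fam → Decl

/-- Signatures, the most recent declaration first. -/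
abbrev Sig := List Decl

/-- Contexts, the most recent variable first: the head of the list is the type of the variable
with index `0`, and each type is given relative to the rest of the list. The concatenation
`Γ, Γ'` is therefore the list `Γ' ++ Γ`; here `Γ'` may depend on the variables of `Γ`. -/
abbrev Ctx := List Fam

/-- The type of a variable, relative to the whole context. -/
def lookup : Ctx → ℕ → Option Fam
  | [], _ => none
  | A :: _, 0 => some (A.shift 1)
  | _ :: Γ, n + 1 => (lookup Γ n).map (fun A => A.shift 1)

/-- `Γ[s]` for a context `Γ` that depends on the variables that `s` acts on. -/
def substCtx (s : Sub) : Ctx → Ctx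
  | [] => []
  | A :: Γ => A.subst (liftN Γ.length s) :: substCtx s Γ

mutual

/-- `⊢ Γ ctx` -/
inductive CtxValid (Sg : Sig) : Ctx → Prop
  | nil : CtxValid Sg []
  | cons {Γ : Ctx} {A : Fam} : CtxValid Sg Γ → FamTyped Sg Γ A .typ → CtxValid Sg (A :: Γ)

/-- `Γ ⊢ K kind` -/
inductive KindValid (Sg : Sig) : Ctx → Kind → Prop
  | typ {Γ : Ctx} : CtxValid Sg Γ → KindValid Sg Γ .typ
  | piK {Γ : Ctx} {A : Fam} {K : Kind} : KindValid Sg (A :: Γ) K → KindValid Sg Γ (.piK A K)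

/-- `Γ ⊢ A : K` -/
inductive FamTyped (Sg : Sig) : Ctx → Fam → Kind → Prop
  | fcon {Γ : Ctx} {a : ℕ} {K : Kind} :
      Decl.fam a K ∈ Sg → CtxValid Sg Γ → FamTyped Sg Γ (.fcon a) K
  | pi {Γ : Ctx} {A B : Fam} : FamTyped Sg (A :: Γ) B .typ → FamTyped Sg Γ (.pi A B) .typ
  | flam {Γ : Ctx} {A B : Fam} {K : Kind} :
      FamTyped Sg (A :: Γ) B K → FamTyped Sg Γ (.flam A B) (.piK A K)
  | fapp {Γ : Ctx} {A B : Fam} {K : Kind} {M : Obj} :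
      FamTyped Sg Γ A (.piK B K) → ObjTyped Sg Γ M B → FamTyped Sg Γ (.fapp A M) (K.inst M)
  | conv {Γ : Ctx} {A : Fam} {K K' : Kind} :
      FamTyped Sg Γ A K → KindValid Sg Γ K' → Conv K K' → FamTyped Sg Γ A K'

/-- `Γ ⊢ M : A` -/
inductive ObjTyped (Sg : Sig) : Ctx → Obj → Fam → Prop
  | con {Γ : Ctx} {c : ℕ} {A : Fam} :
      Decl.obj c A ∈ Sg → CtxValid Sg Γ → ObjTyped Sg Γ (.con c) A
  | var {Γ : Ctx} {n : ℕ} {A : Fam} :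
      lookup Γ n = some A → CtxValid Sg Γ → ObjTyped Sg Γ (.var n) A
  | lam {Γ : Ctx} {A B : Fam} {M : Obj} :
      ObjTyped Sg (A :: Γ) M B → ObjTyped Sg Γ (.lam A M) (.pi A B)
  | app {Γ : Ctx} {A B : Fam} {M N : Obj} :
      ObjTyped Sg Γ M (.pi A B) → ObjTyped Sg Γ N A → ObjTyped Sg Γ (.app M N) (B.inst N)
  | conv {Γ : Ctx} {A A' : Fam} {M : Obj} :
      ObjTyped Sg Γ M A → FamTyped Sg Γ A' .typ → Conv A A' → ObjTyped Sg Γ M A'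

end

/-- `⊢ Σ sig` -/
inductive SigValid : Sig → Prop
  | nil : SigValid []
  | fam {Sg : Sig} {a : ℕ} {K : Kind} :
      SigValid Sg → KindValid Sg [] K → (∀ K', Decl.fam a K' ∉ Sg) → SigValid (.fam a K :: Sg)
  | obj {Sg : Sig} {c : ℕ} {A : Fam} :
      SigValid Sg → FamTyped Sg [] A .typ → (∀ A', Decl.obj c A' ∉ Sg) →
      SigValid (.obj c A :: Sg)

/-- `Γ ⊢ s : Γ'`. The two clauses are the rules for the empty substitution and for `(s, M/x)`. -/
def SubTyped (Sg : Sig) (Γ : Ctx) : Sub → Ctx → Prop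
  | _, [] => True
  | s, A :: Γ' =>
      ObjTyped Sg Γ (s 0) (A.subst (fun n => s (n + 1))) ∧
        SubTyped Sg Γ (fun n => s (n + 1)) Γ'

/-- `Γ ⊢ (M₁/x₁, …, Mₖ/xₖ) : Γ'` for a context `Γ' = x₁, …, xₖ` that may itself depend on `Γ`. -/
def InstTyped (Sg : Sig) (Γ : Ctx) (Ms : List Obj) (Γ' : Ctx) : Prop :=
  Ms.length = Γ'.length ∧ SubTyped Sg Γ (listSub Ms) Γ'

/-- `Π Γ. K` -/
def piCtxK : Ctx → Kind → Kind
  | [], K => K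
  | A :: Γ, K => piCtxK Γ (.piK A K)

/-- `Π Γ. B` -/
def piCtx : Ctx → Fam → Fam
  | [], B => B
  | A :: Γ, B => piCtx Γ (.pi A B)

/-- `A M₁ … Mₙ` -/
def fapps (A : Fam) (Ms : List Obj) : Fam := Ms.foldl .fapp A

/-- `M M₁ … Mₙ` -/
def apps (M : Obj) (Ms : List Obj) : Obj := Ms.foldl .app M

/-- The list `x₁, …, xₙ` of the last `n` variables, the oldest one first. -/
def lastVars (n : ℕ) : List Obj := (List.range n).reverse.map .var

/-- Atomic types `a M₁ … Mₙ`. -/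
def IsAtomic (A : Fam) : Prop := ∃ (a : ℕ) (Ms : List Obj), A = fapps (.fcon a) Ms

/-- Free occurrence of a variable. -/
def Exp.Occurs : {l : Lvl} → ℕ → Exp l → Prop
  | _, _, .typ => False
  | _, n, .piK A K => A.Occurs n ∨ K.Occurs (n + 1)
  | _, _, .fcon _ => False
  | _, n, .pi A B => A.Occurs n ∨ B.Occurs (n + 1)
  | _, n, .flam A B => A.Occurs n ∨ B.Occurs (n + 1)
  | _, n, .fapp A M => A.Occurs n ∨ M.Occurs n
  | _, _, .con _ => False
  | _, n, .var m => n = m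
  | _, n, .lam A M => A.Occurs n ∨ M.Occurs (n + 1)
  | _, n, .app M N => M.Occurs n ∨ N.Occurs n

/-! ## Unification problems of the case rule -/

/-- `θ` is a unifier of `(A = A_c, x = c Γ_c)` with `Γ' ⊢ θ : (Γ₁, x : A, Γ_c)`. -/
def IsUnifier (Sg : Sig) (Γ₁ : Ctx) (A : Fam) (c : ℕ) (Γc : Ctx) (Ac : Fam)
    (Γ' : Ctx) (θ : Sub) : Prop :=
  CtxValid Sg Γ' ∧ SubTyped Sg Γ' θ (Γc ++ A :: Γ₁) ∧
  Conv ((A.shift (Γc.length + 1)).subst θ) (Ac.subst θ) ∧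
  Conv (θ Γc.length) ((apps (.con c) (lastVars Γc.length)).subst θ)

/-- `θ = mgu(A = A_c, x = c Γ_c)` with `Γ' ⊢ θ : (Γ₁, x : A, Γ_c)`. -/
def IsMGU (Sg : Sig) (Γ₁ : Ctx) (A : Fam) (c : ℕ) (Γc : Ctx) (Ac : Fam)
    (Γ' : Ctx) (θ : Sub) : Prop :=
  IsUnifier Sg Γ₁ A c Γc Ac Γ' θ ∧
  ∀ (Γ'' : Ctx) (η : Sub), IsUnifier Sg Γ₁ A c Γc Ac Γ'' η →
    ∃ γ : Sub, SubTyped Sg Γ'' γ Γ' ∧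
      ∀ n < (Γc ++ A :: Γ₁).length, Conv (η n) ((θ n).subst γ)

/-- `A = A_c[s]` with `Γ₁, Γ_c' ⊢ s : Γ_c`, where `A` is a type over `Γ₁`. -/
def IsMatch (Sg : Sig) (Γ₁ : Ctx) (A : Fam) (Γc : Ctx) (Ac : Fam)
    (Γc' : Ctx) (s : Sub) : Prop :=
  CtxValid Sg (Γc' ++ Γ₁) ∧ SubTyped Sg (Γc' ++ Γ₁) s Γc ∧
  Conv (A.shift Γc'.length) (Ac.subst s)

/-- `s` is a most general substitution with `A = A_c[s]`: every other one is obtained from it by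
instantiating the variables of `Γ_c'` only. -/
def IsMostGeneralMatch (Sg : Sig) (Γ₁ : Ctx) (A : Fam) (Γc : Ctx) (Ac : Fam)
    (Γc' : Ctx) (s : Sub) : Prop :=
  IsMatch Sg Γ₁ A Γc Ac Γc' s ∧
  ∀ (Γc'' : Ctx) (t : Sub), IsMatch Sg Γ₁ A Γc Ac Γc'' t →
    ∃ γ : Sub, SubTyped Sg (Γc'' ++ Γ₁) γ (Γc' ++ Γ₁) ∧
      (∀ n < Γ₁.length, Conv (γ (n + Γc'.length)) (.var (n + Γc''.length))) ∧
      ∀ n < Γc.length, Conv (t n) ((s n).subst γ)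

/-- The substitution `(id, (c Γ_c)[s]/x, s)` from `Γ₁, x, Γ_c` to `Γ₁, Γ_c'`, where `Γ_c` has
`k` variables, `Γ_c'` has `k'` variables and `s` acts on `Γ_c`. -/
def splitSub (c k k' : ℕ) (s : Sub) : Sub := fun n =>
  if n < k then s n
  else if n = k then (apps (.con c) (lastVars k)).subst s
  else .var (n - (k + 1) + k')

end LF

/-! ## The logic M2 -/

namespace M2

open LF

/-- The formula `∀ Γ₁. ∃ Γ₂. ⊤`; here `Γ₂` may depend on `Γ₁`. -/
structure Formula where
  all : Ctx
  ex : Ctx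

def Formula.subst (s : Sub) (F : Formula) : Formula :=
  ⟨substCtx s F.all, substCtx (liftN F.all.length s) F.ex⟩

/-- Weakening of a formula by `k` variables. -/
def Formula.shift (k : ℕ) (F : Formula) : Formula := F.subst (fun n => .var (n + k))

def Formula.Valid (Sg : Sig) (Γ : Ctx) (F : Formula) : Prop := CtxValid Sg (F.ex ++ (F.all ++ Γ))

/-- `Γ; Δ ⊢ F` is a sequent of M2: `Γ` is a valid LF context and `Δ`, `F` are given over it. -/
def SeqValid (Sg : Sig) (Γ : Ctx) (Δ : List Formula) (F : Formula) : Prop :=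
  CtxValid Sg Γ ∧ (∀ G ∈ Δ, Formula.Valid Sg Γ G) ∧ Formula.Valid Sg Γ F

/-- The context `Γ'` is a permutation of `Γ`: the variable `n` of `Γ` is the variable `r n` of
`Γ'`. As always, LF types are identified up to definitional equality. -/
structure IsPermutation (r : ℕ → ℕ) (Γ Γ' : Ctx) : Prop where
  length_eq : Γ.length = Γ'.length
  maps_to : ∀ n < Γ.length, r n < Γ'.length
  inj : ∀ m < Γ.length, ∀ n < Γ.length, r m = r n → m = n
  types : ∀ n A, lookup Γ n = some A → ∃ A', lookup Γ' (r n) = some A' ∧ Conv A' (A.rename r)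

mutual

/-- Derivability of the sequent `Γ; Δ ⊢ F` by the quantifier rules and the case rule of M2. -/
inductive Derivable (Sg : Sig) : Ctx → List Formula → Formula → Prop
  | allL {Γ : Ctx} {Δ : List Formula} {F : Formula} (Γ₁ Γ₂ : Ctx) (Ms : List Obj) :
      ⟨Γ₁, Γ₂⟩ ∈ Δ → InstTyped Sg Γ Ms Γ₁ →
      Derivable Sg Γ (⟨[], substCtx (listSub Ms) Γ₂⟩ :: Δ) F →
      Derivable Sg Γ Δ F
  | exL {Γ : Ctx} {Δ : List Formula} {F : Formula} (Γ₁ : Ctx) :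
      ⟨[], Γ₁⟩ ∈ Δ →
      Derivable Sg (Γ₁ ++ Γ) (Δ.map (Formula.shift Γ₁.length)) (F.shift Γ₁.length) →
      Derivable Sg Γ Δ F
  | allR {Γ : Ctx} {Δ : List Formula} (Γ₁ Γ₂ : Ctx) :
      Derivable Sg (Γ₁ ++ Γ) (Δ.map (Formula.shift Γ₁.length)) ⟨[], Γ₂⟩ →
      Derivable Sg Γ Δ ⟨Γ₁, Γ₂⟩
  | exR {Γ : Ctx} {Δ : List Formula} (Γ₁ : Ctx) (Ms : List Obj) :
      InstTyped Sg Γ Ms Γ₁ → Derivable Sg Γ Δ ⟨[], Γ₁⟩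
  | case {Γ : Ctx} {Δ : List Formula} {F : Formula} (Γ₁ : Ctx) (A : Fam) (Γ₂ : Ctx)
      (r : ℕ → ℕ) :
      IsPermutation r Γ (Γ₂ ++ A :: Γ₁) → CtxValid Sg (Γ₂ ++ A :: Γ₁) → IsAtomic A →
      CaseDerivable Sg Γ₁ A Γ₂ (Δ.map (Formula.subst (fun n => .var (r n))))
        (F.subst (fun n => .var (r n))) Sg →
      Derivable Sg Γ Δ F

/-- The judgment of the case rule for `Γ₁, x : A, Γ₂; Δ ⊢ F` and for the constants of a part
(the last argument) of the signature. Declarations of type families contribute no case. -/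
inductive CaseDerivable (Sg : Sig) : Ctx → Fam → Ctx → List Formula → Formula → Sig → Prop
  | empty {Γ₁ : Ctx} {A : Fam} {Γ₂ : Ctx} {Δ : List Formula} {F : Formula} :
      CaseDerivable Sg Γ₁ A Γ₂ Δ F []
  | fam {Γ₁ : Ctx} {A : Fam} {Γ₂ : Ctx} {Δ : List Formula} {F : Formula} {S : Sig}
      (a : ℕ) (K : Kind) :
      CaseDerivable Sg Γ₁ A Γ₂ Δ F S → CaseDerivable Sg Γ₁ A Γ₂ Δ F (.fam a K :: S)
  | nonuni {Γ₁ : Ctx} {A : Fam} {Γ₂ : Ctx} {Δ : List Formula} {F : Formula} {S : Sig}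
      (c : ℕ) (Γc : Ctx) (Ac : Fam) :
      IsAtomic Ac → (¬ ∃ Γ' θ, IsUnifier Sg Γ₁ A c Γc Ac Γ' θ) →
      CaseDerivable Sg Γ₁ A Γ₂ Δ F S →
      CaseDerivable Sg Γ₁ A Γ₂ Δ F (.obj c (piCtx Γc Ac) :: S)
  | uni {Γ₁ : Ctx} {A : Fam} {Γ₂ : Ctx} {Δ : List Formula} {F : Formula} {S : Sig}
      (c : ℕ) (Γc : Ctx) (Ac : Fam) (Γ' : Ctx) (θ : Sub) :
      IsAtomic Ac → IsMGU Sg Γ₁ A c Γc Ac Γ' θ →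
      Derivable Sg (substCtx (fun n => θ (n + Γc.length)) Γ₂ ++ Γ')
        (Δ.map (Formula.subst (liftN Γ₂.length (fun n => θ (n + Γc.length)))))
        (F.subst (liftN Γ₂.length (fun n => θ (n + Γc.length)))) →
      CaseDerivable Sg Γ₁ A Γ₂ Δ F S →
      CaseDerivable Sg Γ₁ A Γ₂ Δ F (.obj c (piCtx Γc Ac) :: S)

end

/-! ## Clauses and their translation to M2 proofs -/

/-- The arguments of an atomic type `a M₁ … Mₙ`, divided into inputs and outputs. -/
structure Args where
  ins : List Obj
  outs : List Obj

/-- A clause `c : a M₁ … Mₙ ← a M₁₁ … M₁ₙ ← ⋯ ← a Mₘ₁ … Mₘₙ` for the moded type family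
`a : Π Γᴵ. Π Γᴼ. type`. The context `vars` holds the variables of the clause, over which the head
and the premises are given. -/
structure Clause where
  fam : ℕ
  inCtx : Ctx
  outCtx : Ctx
  con : ℕ
  vars : Ctx
  head : Args
  premises : List Args

namespace Clause

variable (K : Clause)

/-- The type `a M₁ … Mₙ`. -/
def callType (X : Args) : Fam := fapps (.fcon K.fam) (X.ins ++ X.outs)

/-- The type `Aₘ → ⋯ → A₁ → A` of the clause, over its variables. -/
def body : Fam :=
  (K.premises.map K.callType).foldl (fun B A => .pi A (B.shift 1)) (K.callType K.head)

/-- The numbers of inputs and outputs are those of the type family. -/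
def ArgsFit (X : Args) : Prop :=
  X.ins.length = K.inCtx.length ∧ X.outs.length = K.outCtx.length

/-- The clause and its type family are declared in the signature. -/
structure InSig (Sg : Sig) : Prop where
  fam_mem : Decl.fam K.fam (piCtxK (K.outCtx ++ K.inCtx) .typ) ∈ Sg
  con_mem : Decl.obj K.con (piCtx K.vars K.body) ∈ Sg
  head_fit : K.ArgsFit K.head
  premises_fit : ∀ X ∈ K.premises, K.ArgsFit X

/-- `Γᴼ, D : a Γᴵ Γᴼ`, a context over `Γᴵ`. -/
def outTel : Ctx :=
  fapps (.fcon K.fam) (lastVars (K.outCtx.length + K.inCtx.length)) :: K.outCtx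

/-- The induction hypothesis `∀ Γᴵ. ∃ Γᴼ. ∃ D : a Γᴵ Γᴼ. ⊤`. -/
def indHyp : Formula := ⟨K.inCtx, K.outTel⟩

/-- `Γᴼ[s], D : a s Γᴼ` for a list `s` of inputs. -/
def callTel (s : List Obj) : Ctx := substCtx (listSub s) K.outTel

/-- The variables of the clause that occur in `Ms`, or in the type of such a variable, and
so on. -/
inductive Needs (Ms : List Obj) : ℕ → Prop
  | occurs {M : Obj} {n : ℕ} : M ∈ Ms → M.Occurs n → Needs Ms n
  | type {m n : ℕ} {A : Fam} : Needs Ms m → lookup K.vars m = some A → A.Occurs n → Needs Ms n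

/-- The contexts of the translation are built from slots: `inl n` stands for the variable `n` of
the clause and `inr i` for the variable `Dᵢ : Aᵢ` of the premise number `i` (counted from `0`). -/
abbrev Slot := ℕ ⊕ ℕ

/-- The `i`-th premise. -/
def premise (i : ℕ) : Args := K.premises.getD i ⟨[], []⟩

/-- The type of a slot, over the variables of the clause. -/
def slotType : Slot → Fam
  | .inl n => (lookup K.vars n).getD (.fcon 0)
  | .inr i => K.callType (K.premise i)

/-- The place of the variable `n` of the clause in the context given by `ss`. -/
def place (ss : List Slot) (n : ℕ) : ℕ := ss.idxOf (Sum.inl n)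

/-- The context given by a list of slots, the most recent one first. -/
def slotCtx : List Slot → Ctx
  | [] => []
  | s :: ss => (K.slotType s).rename (place ss) :: slotCtx ss

open Classical in
/-- The variables needed for `Ms` that are not present in `ss`, in the order of the clause. -/
noncomputable def newVars (Ms : List Obj) (ss : List Slot) : List Slot :=
  ((List.range K.vars.length).filter
    (fun n => decide (K.Needs Ms n ∧ (Sum.inl n : Slot) ∉ ss))).map Sum.inl

/-- The slots of the context after the first `i` recursive calls: first the input variables of
the head, then for each premise its output variables and the variable `Dᵢ`. -/
noncomputable def slots : ℕ → List Slot
  | 0 => K.newVars K.head.ins []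
  | i + 1 => Sum.inr i :: (K.newVars (K.premise i).outs (slots i) ++ slots i)

/-- The context `Γ_{c_i}`. -/
noncomputable def ctx (i : ℕ) : Ctx := K.slotCtx (K.slots i)

/-- Objects over the variables of the clause, read in `Γ_{c_i}`. -/
noncomputable def read (i : ℕ) (Ms : List Obj) : List Obj :=
  Ms.map (Exp.rename (place (K.slots i)))

/-- The goal formula of `S_{c_i}`: the outputs asked for at the inputs of the head. -/
noncomputable def goal (i : ℕ) : Formula := ⟨[], K.callTel (K.read i K.head.ins)⟩

/-- `Γᴼ[σᵢ], D : a σᵢ Γᴼ` for the inputs `σᵢ` of the `i`-th premise, over `Γ_{c_i}`. -/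
noncomputable def premTel (i : ℕ) : Ctx := K.callTel (K.read i (K.premise i).ins)

/-- The witnesses at the end of the translation: the outputs of the head and the object
`c Γ Dₘ … D₁`, where `Γ` are the variables of the clause. -/
noncomputable def witnesses : List Obj :=
  K.read K.premises.length K.head.outs ++
    [apps (.con K.con)
      (K.read K.premises.length (lastVars K.vars.length) ++
        (List.range K.premises.length).reverse.map
          (fun i => .var ((K.slots K.premises.length).idxOf (Sum.inr i))))]

end Clause

/-- The points reached by the translation: the sequent `S_{c_i}`; the same after `∀L` for the
`i`-th premise; and a sequent that corresponds to an output coverage goal of the `i`-th premise. -/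
inductive Phase : Type
  | start : ℕ → Phase
  | called : ℕ → Phase
  | split : ℕ → Phase

mutual

/-- `Gen Sg K p Γᴵ Γᴼ Δ F`: at the point `p`, the translation of the clause `K` generates an M2
proof of `Γᴵ, Γᴼ; Δ ⊢ F`. Here `Γᴵ` counts as input and `Γᴼ` as output. -/
inductive Gen (Sg : Sig) (K : Clause) : Phase → Ctx → Ctx → List Formula → Formula → Prop
  /-- The base step: the outputs of the head are constructed by `∃R`. -/
  | base {Δ : List Formula} :
      InstTyped Sg (K.ctx K.premises.length) K.witnesses (K.goal K.premises.length).ex →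
      Gen Sg K (.start K.premises.length) (K.ctx K.premises.length) [] Δ
        (K.goal K.premises.length)
  /-- A recursive call: `∀L` on the induction hypothesis, at the inputs of the premise. -/
  | call {i : ℕ} {Δ : List Formula} :
      i < K.premises.length → K.indHyp ∈ Δ →
      InstTyped Sg (K.ctx i) (K.read i (K.premise i).ins) K.inCtx →
      Gen Sg K (.called i) (K.ctx i) [] (⟨[], K.premTel i⟩ :: Δ) (K.goal i) →
      Gen Sg K (.start i) (K.ctx i) [] Δ (K.goal i)
  /-- The results of the recursive call are introduced by `∃L`. -/
  | results {i : ℕ} {Δ : List Formula} :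
      ⟨[], K.premTel i⟩ ∈ Δ →
      Gen Sg K (.split i) (K.ctx i) (K.premTel i)
        (Δ.map (Formula.shift (K.premTel i).length)) ((K.goal i).shift (K.premTel i).length) →
      Gen Sg K (.called i) (K.ctx i) [] Δ (K.goal i)
  /-- Output splitting on a variable `x : A` of `Γᴼ` (other than the last one, `D`) becomes an
  application of the case rule. -/
  | split {i : ℕ} {Γi Γ₁ Γ₂ : Ctx} {A : Fam} {Δ : List Formula} {F : Formula} :
      IsAtomic A → Γ₂ ≠ [] →
      GenCases Sg K i Γi Γ₁ A Γ₂ Δ F Sg →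
      Gen Sg K (.split i) Γi (Γ₂ ++ A :: Γ₁) Δ F
  /-- Immediate output coverage: the sequent is obtained from `S_{c_{i+1}}` by a renaming that
  affects only the outputs of the premise, and its proof by renaming that of `S_{c_{i+1}}`. -/
  | covered {i : ℕ} {Γo : Ctx} {Δ : List Formula} (r : ℕ → ℕ) :
      IsPermutation r (K.ctx (i + 1)) (Γo ++ K.ctx i) →
      r 0 = 0 → (∀ n, Γo.length ≤ n → r n = n) →
      SeqValid Sg (K.ctx (i + 1)) Δ (K.goal (i + 1)) →
      Gen Sg K (.start (i + 1)) (K.ctx (i + 1)) [] Δ (K.goal (i + 1)) →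
      Gen Sg K (.split i) (K.ctx i) Γo (Δ.map (Formula.subst (fun n => .var (r n))))
        ((K.goal (i + 1)).subst (fun n => .var (r n)))

/-- The cases generated by output splitting on `x : A` in `Γᴵ; Γ₁, x : A, Γ₂`, for the constants
of a part (the last argument) of the signature. A constant gives no subgoal if `A` is not an
instance of its target type, and otherwise it gives one for a most general matching substitution;
the conditions of the case rule of M2 are those on unifiers. -/
inductive GenCases (Sg : Sig) (K : Clause) :
    ℕ → Ctx → Ctx → Fam → Ctx → List Formula → Formula → Sig → Prop
  | empty {i : ℕ} {Γi Γ₁ : Ctx} {A : Fam} {Γ₂ : Ctx} {Δ : List Formula} {F : Formula} :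
      GenCases Sg K i Γi Γ₁ A Γ₂ Δ F []
  | fam {i : ℕ} {Γi Γ₁ : Ctx} {A : Fam} {Γ₂ : Ctx} {Δ : List Formula} {F : Formula} {S : Sig}
      (a : ℕ) (L : Kind) :
      GenCases Sg K i Γi Γ₁ A Γ₂ Δ F S → GenCases Sg K i Γi Γ₁ A Γ₂ Δ F (.fam a L :: S)
  | nonuni {i : ℕ} {Γi Γ₁ : Ctx} {A : Fam} {Γ₂ : Ctx} {Δ : List Formula} {F : Formula} {S : Sig}
      (c : ℕ) (Γc : Ctx) (Ac : Fam) :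
      IsAtomic Ac →
      (¬ ∃ Γc' s, IsMatch Sg (Γ₁ ++ Γi) A Γc Ac Γc' s) →
      (¬ ∃ Γ' θ, IsUnifier Sg (Γ₁ ++ Γi) A c Γc Ac Γ' θ) →
      GenCases Sg K i Γi Γ₁ A Γ₂ Δ F S →
      GenCases Sg K i Γi Γ₁ A Γ₂ Δ F (.obj c (piCtx Γc Ac) :: S)
  | uni {i : ℕ} {Γi Γ₁ : Ctx} {A : Fam} {Γ₂ : Ctx} {Δ : List Formula} {F : Formula} {S : Sig}
      (c : ℕ) (Γc : Ctx) (Ac : Fam) (Γc' : Ctx) (s θ : Sub) :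
      IsAtomic Ac →
      IsMostGeneralMatch Sg (Γ₁ ++ Γi) A Γc Ac Γc' s →
      θ = splitSub c Γc.length Γc'.length s →
      IsMGU Sg (Γ₁ ++ Γi) A c Γc Ac (Γc' ++ (Γ₁ ++ Γi)) θ →
      Gen Sg K (.split i) Γi (substCtx (fun n => θ (n + Γc.length)) Γ₂ ++ (Γc' ++ Γ₁))
        (Δ.map (Formula.subst (liftN Γ₂.length (fun n => θ (n + Γc.length)))))
        (F.subst (liftN Γ₂.length (fun n => θ (n + Γc.length)))) →
      GenCases Sg K i Γi Γ₁ A Γ₂ Δ F S →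
      GenCases Sg K i Γi Γ₁ A Γ₂ Δ F (.obj c (piCtx Γc Ac) :: S)

end

/-- `Γ₁, Γ₂; Δ ⊢ F` has an M2 proof generated by the translation of the clause `K`, where `Γ₁` is
an initial part of the input context and `Γ₂` contains the output context. -/
def GeneratedProof (Sg : Sig) (K : Clause) (Γ₁ Γ₂ : Ctx) (Δ : List Formula) (F : Formula) :
    Prop :=
  ∃ (p : Phase) (Γr Γo : Ctx), Γ₂ = Γo ++ Γr ∧ Gen Sg K p (Γr ++ Γ₁) Γo Δ F

end M2

namespace LF

/-! ## Substitution calculus -/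

/-- `(comp s t) n = (s n)[t]`: first `s`, then `t`. -/
def comp (s t : Sub) : Sub := fun n => (s n).subst t

theorem lift_var (r : ℕ → ℕ) : lift (fun n => .var (r n)) = fun n => .var (liftRen r n) := by
  funext n; cases n <;> rfl

theorem rename_eq_subst {l : Lvl} (e : Exp l) (r : ℕ → ℕ) :
    e.rename r = e.subst (fun n => .var (r n)) := by
  induction e generalizing r <;> simp_all [Exp.rename, Exp.subst, lift_var]

theorem lift_liftRen (r : ℕ → ℕ) (s : Sub) :
    (fun n => lift s (liftRen r n)) = lift (fun n => s (r n)) := by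
  funext n; cases n <;> rfl

theorem rename_subst {l : Lvl} (e : Exp l) (r : ℕ → ℕ) (s : Sub) :
    (e.rename r).subst s = e.subst (fun n => s (r n)) := by
  induction e generalizing r s <;> simp only [Exp.rename, Exp.subst, lift_liftRen, *]

theorem rename_rename {l : Lvl} (e : Exp l) (r q : ℕ → ℕ) :
    (e.rename r).rename q = e.rename (fun n => q (r n)) := by
  rw [rename_eq_subst _ q, rename_subst, rename_eq_subst]

theorem subst_rename {l : Lvl} (e : Exp l) (s : Sub) (r : ℕ → ℕ) :
    (e.subst s).rename r = e.subst (fun n => (s n).rename r) := by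
  have h : ∀ (s : Sub) (r : ℕ → ℕ),
      lift (fun n => (s n).rename r) = fun n => (lift s n).rename (liftRen r) := by
    intro s r; funext n
    cases n
    · rfl
    · simp [lift, Exp.shift, rename_rename, liftRen]
  induction e generalizing r s <;> simp_all [Exp.rename, Exp.subst]

theorem lift_comp (s t : Sub) : lift (comp s t) = comp (lift s) (lift t) := by
  funext n
  cases n
  · rfl
  · simp [lift, comp, Exp.shift, rename_subst, subst_rename]

theorem subst_subst {l : Lvl} (e : Exp l) (s t : Sub) :
    (e.subst s).subst t = e.subst (comp s t) := by
  induction e generalizing s t <;> simp_all [Exp.subst, lift_comp]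
  rfl

theorem subst_var {l : Lvl} (e : Exp l) : e.subst Exp.var = e := by
  have h : lift Exp.var = Exp.var := by funext n; cases n <;> rfl
  induction e <;> simp_all [Exp.subst]

theorem rename_id {l : Lvl} (e : Exp l) : e.rename id = e := by
  rw [rename_eq_subst]; exact subst_var e

theorem shift_subst {l : Lvl} (e : Exp l) (k : ℕ) (s : Sub) :
    (e.shift k).subst s = e.subst (fun n => s (n + k)) := rename_subst e _ s

theorem shift_zero {l : Lvl} (e : Exp l) : e.shift 0 = e := rename_id e

theorem shift_shift {l : Lvl} (e : Exp l) (j k : ℕ) : (e.shift j).shift k = e.shift (j + k) := by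
  simp only [Exp.shift, rename_rename, Nat.add_assoc]

theorem shift_eq_subst {l : Lvl} (e : Exp l) (k : ℕ) :
    e.shift k = e.subst (fun n => .var (n + k)) := rename_eq_subst e _

theorem comp_var (s : Sub) : comp s Exp.var = s := by
  funext n; exact subst_var (s n)

theorem liftN_lt {k n : ℕ} (s : Sub) (h : n < k) : liftN k s n = .var n := by
  induction k generalizing n with
  | zero => omega
  | succ k ih =>
    cases n with
    | zero => rfl
    | succ n => simp [liftN, lift, ih (Nat.lt_of_succ_lt_succ h), Exp.shift, Exp.rename]

theorem liftN_add (k n : ℕ) (s : Sub) : liftN k s (n + k) = (s n).shift k := by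
  induction k with
  | zero => exact (shift_zero _).symm
  | succ k ih =>
    change (liftN k s (n + k)).shift 1 = _
    rw [ih, shift_shift]

theorem sub_ext {s t : Sub} (k : ℕ) (h₁ : ∀ n < k, s n = t n)
    (h₂ : ∀ n, s (n + k) = t (n + k)) : s = t := by
  funext n
  rcases Nat.lt_or_ge n k with h | h
  · exact h₁ n h
  · obtain ⟨m, rfl⟩ := Nat.exists_eq_add_of_le' h
    exact h₂ m

theorem liftN_comp (k : ℕ) (s t : Sub) : liftN k (comp s t) = comp (liftN k s) (liftN k t) := by
  induction k with
  | zero => rfl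
  | succ k ih => simp only [liftN, ih, lift_comp]

theorem liftN_liftN (j k : ℕ) (s : Sub) : liftN j (liftN k s) = liftN (j + k) s := by
  induction j with
  | zero => simp [liftN]
  | succ j ih => rw [Nat.add_right_comm]; simp only [liftN, ih]

theorem liftN_var (k : ℕ) : liftN k Exp.var = Exp.var := by
  refine sub_ext k (fun n h => liftN_lt _ h) (fun n => ?_)
  rw [liftN_add]; rfl

theorem comp_liftN_lt {k n : ℕ} (s t : Sub) (h : n < k) : comp (liftN k s) t n = t n := by
  simp [comp, liftN_lt s h, Exp.subst]

theorem comp_liftN_add (k n : ℕ) (s t : Sub) :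
    comp (liftN k s) t (n + k) = comp s (fun n => t (n + k)) n := by
  simp [comp, liftN_add, shift_subst]

theorem listSub_lt {Ms : List Obj} {n : ℕ} (h : n < Ms.length) :
    listSub Ms n = Ms.reverse[n]'(by simpa using h) := by
  simp [listSub, List.getD, h]

theorem listSub_add (Ms : List Obj) (n : ℕ) : listSub Ms (n + Ms.length) = .var n := by
  simp [listSub, List.getD]

theorem comp_listSub (Ms : List Obj) (s : Sub) :
    comp (listSub Ms) s = comp (liftN Ms.length s) (listSub (Ms.map (Exp.subst s))) := by
  refine sub_ext Ms.length (fun n h => ?_) (fun n => ?_)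
  · rw [comp_liftN_lt _ _ h, comp, listSub_lt h, listSub_lt (by simpa using h)]
    simp
  · rw [comp_liftN_add, comp, listSub_add]
    have := fun m => listSub_add (Ms.map (Exp.subst s)) m
    simp only [List.length_map] at this
    simp only [comp, this, Exp.subst]
    exact (subst_var _).symm

theorem inst_subst {l : Lvl} (e : Exp l) (M : Obj) (s : Sub) :
    (e.inst M).subst s = (e.subst (lift s)).inst (M.subst s) := by
  simp only [Exp.inst, subst_subst]
  rw [comp_listSub]
  rfl

theorem shift_one_subst_lift {l : Lvl} (e : Exp l) (s : Sub) :
    (e.shift 1).subst (lift s) = (e.subst s).shift 1 := by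
  rw [shift_subst, Exp.shift, subst_rename]; rfl

theorem length_substCtx (s : Sub) (Γ : Ctx) : (substCtx s Γ).length = Γ.length := by
  induction Γ <;> simp_all [substCtx]

theorem substCtx_append (s : Sub) (Γ₂ Γ₁ : Ctx) :
    substCtx s (Γ₂ ++ Γ₁) = substCtx (liftN Γ₁.length s) Γ₂ ++ substCtx s Γ₁ := by
  induction Γ₂ with
  | nil => rfl
  | cons A Γ₂ ih => simp [substCtx, ih, liftN_liftN]

theorem substCtx_substCtx (s t : Sub) (Γ : Ctx) :
    substCtx t (substCtx s Γ) = substCtx (comp s t) Γ := by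
  induction Γ with
  | nil => rfl
  | cons A Γ ih => simp [substCtx, ih, length_substCtx, subst_subst, liftN_comp]

theorem substCtx_var (Γ : Ctx) : substCtx Exp.var Γ = Γ := by
  induction Γ with
  | nil => rfl
  | cons A Γ ih => simp [substCtx, ih, liftN_var, subst_var]

theorem fapps_subst (A : Fam) (Ms : List Obj) (s : Sub) :
    (fapps A Ms).subst s = fapps (A.subst s) (Ms.map (Exp.subst s)) := by
  induction Ms generalizing A with
  | nil => rfl
  | cons M Ms ih => exact ih _

theorem IsAtomic.subst {A : Fam} (h : IsAtomic A) (s : Sub) : IsAtomic (A.subst s) := by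
  obtain ⟨a, Ms, rfl⟩ := h
  exact ⟨a, Ms.map (Exp.subst s), fapps_subst _ _ _⟩

theorem piCtx_subst (s : Sub) (Γ : Ctx) (B : Fam) :
    (piCtx Γ B).subst s = piCtx (substCtx s Γ) (B.subst (liftN Γ.length s)) := by
  induction Γ generalizing B with
  | nil => rfl
  | cons A Γ ih => simp [piCtx, substCtx, ih, Exp.subst, liftN]

theorem piCtx_inj {Γ Γ' : Ctx} {B B' : Fam} (hl : Γ.length = Γ'.length)
    (h : piCtx Γ B = piCtx Γ' B') : Γ = Γ' ∧ B = B' := by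
  induction Γ generalizing Γ' B B' with
  | nil =>
    cases Γ' with
    | nil => exact ⟨rfl, h⟩
    | cons => simp at hl
  | cons A Γ ih =>
    cases Γ' with
    | nil => simp at hl
    | cons A' Γ' =>
      obtain ⟨rfl, h'⟩ := ih (Γ' := Γ') (by simpa using hl) h
      cases h'
      exact ⟨rfl, rfl⟩

/-! ## Conversion -/

theorem Conv.refl {l : Lvl} (e : Exp l) : Conv e e := Relation.EqvGen.refl e

theorem Conv.symm {l : Lvl} {e f : Exp l} (h : Conv e f) : Conv f e := Relation.EqvGen.symm _ _ h

theorem Conv.trans {l : Lvl} {e f g : Exp l} (h : Conv e f) (h' : Conv f g) : Conv e g :=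
  Relation.EqvGen.trans _ _ _ h h'

theorem Conv.map {l k : Lvl} (φ : Exp l → Exp k) (hφ : ∀ {a b}, Step a b → Step (φ a) (φ b))
    {a b : Exp l} (h : Conv a b) : Conv (φ a) (φ b) := by
  induction h with
  | rel _ _ h => exact .rel _ _ (hφ h)
  | refl _ => exact .refl _
  | symm _ _ _ ih => exact ih.symm
  | trans _ _ _ _ _ ih₁ ih₂ => exact ih₁.trans ih₂

theorem Step.subst {l : Lvl} {e f : Exp l} (h : Step e f) (s : Sub) :
    Step (e.subst s) (f.subst s) := by
  induction h generalizing s with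
  | beta A M N => rw [inst_subst]; exact .beta _ _ _
  | fbeta A B N => rw [inst_subst]; exact .fbeta _ _ _
  | eta A M =>
    simp only [Exp.subst, shift_one_subst_lift]
    exact .eta _ _
  | feta A B =>
    simp only [Exp.subst, shift_one_subst_lift]
    exact .feta _ _
  | piK₁ _ _ ih => exact .piK₁ _ (ih _)
  | piK₂ _ _ ih => exact .piK₂ _ (ih _)
  | pi₁ _ _ ih => exact .pi₁ _ (ih _)
  | pi₂ _ _ ih => exact .pi₂ _ (ih _)
  | flam₁ _ _ ih => exact .flam₁ _ (ih _)
  | flam₂ _ _ ih => exact .flam₂ _ (ih _)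
  | fapp₁ _ _ ih => exact .fapp₁ _ (ih _)
  | fapp₂ _ _ ih => exact .fapp₂ _ (ih _)
  | lam₁ _ _ ih => exact .lam₁ _ (ih _)
  | lam₂ _ _ ih => exact .lam₂ _ (ih _)
  | app₁ _ _ ih => exact .app₁ _ (ih _)
  | app₂ _ _ ih => exact .app₂ _ (ih _)

theorem Conv.subst {l : Lvl} {e f : Exp l} (h : Conv e f) (s : Sub) :
    Conv (e.subst s) (f.subst s) := h.map _ (fun h => h.subst s)

theorem Conv.shift {l : Lvl} {e f : Exp l} (h : Conv e f) (k : ℕ) :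
    Conv (e.shift k) (f.shift k) := by
  rw [shift_eq_subst, shift_eq_subst]; exact h.subst _

/-- Convertible substitutions have convertible results. -/
theorem conv_subst_of_occurs {l : Lvl} (e : Exp l) {s t : Sub}
    (h : ∀ n, e.Occurs n → Conv (s n) (t n)) : Conv (e.subst s) (e.subst t) := by
  have hl : ∀ {l : Lvl} {e : Exp l} {s t : Sub}, (∀ n, e.Occurs (n + 1) → Conv (s n) (t n)) →
      ∀ n, e.Occurs n → Conv (lift s n) (lift t n) := by
    intro l e s t h n hn
    cases n with
    | zero => exact .refl _
    | succ n => exact (h n hn).shift 1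
  induction e generalizing s t with
  | typ => exact .refl _
  | piK A K ihA ihK =>
    exact ((ihA fun n hn => h n (.inl hn)).map (.piK · _) (.piK₁ _)).trans
      ((ihK (hl fun n hn => h n (.inr hn))).map _ (.piK₂ _))
  | fcon a => exact .refl _
  | pi A B ihA ihB =>
    exact ((ihA fun n hn => h n (.inl hn)).map (.pi · _) (.pi₁ _)).trans
      ((ihB (hl fun n hn => h n (.inr hn))).map _ (.pi₂ _))
  | flam A B ihA ihB =>
    exact ((ihA fun n hn => h n (.inl hn)).map (.flam · _) (.flam₁ _)).trans
      ((ihB (hl fun n hn => h n (.inr hn))).map _ (.flam₂ _))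
  | fapp A M ihA ihM =>
    exact ((ihA fun n hn => h n (.inl hn)).map (.fapp · _) (.fapp₁ _)).trans
      ((ihM fun n hn => h n (.inr hn)).map _ (.fapp₂ _))
  | con c => exact .refl _
  | var n => exact h n rfl
  | lam A M ihA ihM =>
    exact ((ihA fun n hn => h n (.inl hn)).map (.lam · _) (.lam₁ _)).trans
      ((ihM (hl fun n hn => h n (.inr hn))).map _ (.lam₂ _))
  | app M N ihM ihN =>
    exact ((ihM fun n hn => h n (.inl hn)).map (.app · _) (.app₁ _)).trans
      ((ihN fun n hn => h n (.inr hn)).map _ (.app₂ _))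

theorem subst_congr_of_occurs {l : Lvl} (e : Exp l) {s t : Sub}
    (h : ∀ n, e.Occurs n → s n = t n) : e.subst s = e.subst t := by
  have hl : ∀ {l : Lvl} {e : Exp l} {s t : Sub}, (∀ n, e.Occurs (n + 1) → s n = t n) →
      ∀ n, e.Occurs n → lift s n = lift t n := by
    intro l e s t h n hn
    cases n with
    | zero => rfl
    | succ n => exact congrArg (Exp.shift 1) (h n hn)
  induction e generalizing s t with
  | typ | fcon | con => rfl
  | var n => exact h n rfl
  | piK A B ihA ihB | pi A B ihA ihB | flam A B ihA ihB | lam A B ihA ihB =>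
    simp only [Exp.subst, ihA fun n hn => h n (.inl hn), ihB (hl fun n hn => h n (.inr hn))]
  | fapp A B ihA ihB | app A B ihA ihB =>
    simp only [Exp.subst, ihA fun n hn => h n (.inl hn), ihB fun n hn => h n (.inr hn)]

theorem subst_eq_self_of_closed {l : Lvl} (e : Exp l) (h : ∀ n, ¬ e.Occurs n) (s : Sub) :
    e.subst s = e :=
  (subst_congr_of_occurs e fun n hn => absurd hn (h n)).trans (subst_var e)

variable {Sg : Sig}

/-! ## Scoping -/

/-- Every type of the context has its free variables among the earlier variables. -/
def CtxScoped : Ctx → Prop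
  | [] => True
  | A :: Γ => CtxScoped Γ ∧ ∀ n, A.Occurs n → n < Γ.length

theorem lookup_lt {Γ : Ctx} {n : ℕ} {A : Fam} (h : lookup Γ n = some A) : n < Γ.length := by
  induction Γ generalizing n A with
  | nil => simp [lookup] at h
  | cons B Γ ih =>
    cases n with
    | zero => simp
    | succ n =>
      obtain ⟨A', h', -⟩ := Option.map_eq_some_iff.1 h
      simpa using ih h'

theorem exists_lookup {Γ : Ctx} {n : ℕ} (h : n < Γ.length) : ∃ A, lookup Γ n = some A := by
  induction Γ generalizing n with
  | nil => simp at h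
  | cons B Γ ih =>
    cases n with
    | zero => exact ⟨_, rfl⟩
    | succ n =>
      obtain ⟨A, hA⟩ := ih (Nat.lt_of_succ_lt_succ h)
      exact ⟨_, Option.map_eq_some_iff.2 ⟨A, hA, rfl⟩⟩

mutual

theorem CtxValid.scoped {Γ : Ctx} : CtxValid Sg Γ → CtxScoped Γ
  | .nil => trivial
  | .cons hΓ hA => ⟨hΓ.scoped, hA.scoped.2⟩

theorem KindValid.scoped {Γ : Ctx} {K : Kind} :
    KindValid Sg Γ K → CtxScoped Γ ∧ ∀ n, K.Occurs n → n < Γ.length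
  | .typ hΓ => ⟨hΓ.scoped, fun _ h => h.elim⟩
  | .piK hK =>
    have ⟨h₁, h₂⟩ := hK.scoped
    ⟨h₁.1, fun n h => h.elim (h₁.2 n) fun h => Nat.lt_of_succ_lt_succ (h₂ _ h)⟩

theorem FamTyped.scoped {Γ : Ctx} {A : Fam} {K : Kind} :
    FamTyped Sg Γ A K → CtxScoped Γ ∧ ∀ n, A.Occurs n → n < Γ.length
  | .fcon _ hΓ => ⟨hΓ.scoped, fun _ h => h.elim⟩
  | .pi hB =>
    have ⟨h₁, h₂⟩ := hB.scoped
    ⟨h₁.1, fun n h => h.elim (h₁.2 n) fun h => Nat.lt_of_succ_lt_succ (h₂ _ h)⟩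
  | .flam hB =>
    have ⟨h₁, h₂⟩ := hB.scoped
    ⟨h₁.1, fun n h => h.elim (h₁.2 n) fun h => Nat.lt_of_succ_lt_succ (h₂ _ h)⟩
  | .fapp hA hM => ⟨hA.scoped.1, fun n h => h.elim (hA.scoped.2 n) (hM.scoped.2 n)⟩
  | .conv hA _ _ => hA.scoped

theorem ObjTyped.scoped {Γ : Ctx} {M : Obj} {A : Fam} :
    ObjTyped Sg Γ M A → CtxScoped Γ ∧ ∀ n, M.Occurs n → n < Γ.length
  | .con _ hΓ => ⟨hΓ.scoped, fun _ h => h.elim⟩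
  | .var hn hΓ => ⟨hΓ.scoped, fun _ h => h ▸ lookup_lt hn⟩
  | .lam hM =>
    have ⟨h₁, h₂⟩ := hM.scoped
    ⟨h₁.1, fun n h => h.elim (h₁.2 n) fun h => Nat.lt_of_succ_lt_succ (h₂ _ h)⟩
  | .app hM hN => ⟨hM.scoped.1, fun n h => h.elim (hM.scoped.2 n) (hN.scoped.2 n)⟩
  | .conv hM _ _ => hM.scoped

end

/-- The declared kinds and types are closed. -/
theorem SigValid.closed (h : SigValid Sg) :
    (∀ a K, Decl.fam a K ∈ Sg → ∀ n, ¬ K.Occurs n) ∧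
    (∀ c A, Decl.obj c A ∈ Sg → ∀ n, ¬ A.Occurs n) := by
  induction h with
  | nil => simp
  | fam _ hK _ ih =>
    refine ⟨fun a K hm n hn => ?_, fun c A hm => ih.2 c A (by simpa using hm)⟩
    rcases List.mem_cons.1 hm with h | h
    · cases h
      exact absurd (hK.scoped.2 n hn) (Nat.not_lt_zero n)
    · exact ih.1 a K h n hn
  | obj _ hA _ ih =>
    refine ⟨fun c A hm => ih.1 c A (by simpa using hm), fun a K hm n hn => ?_⟩
    rcases List.mem_cons.1 hm with h | h
    · cases h
      exact absurd (hA.scoped.2 n hn) (Nat.not_lt_zero n)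
    · exact ih.2 a K h n hn

theorem SigValid.fam_subst (h : SigValid Sg) {a : ℕ} {K : Kind} (hm : Decl.fam a K ∈ Sg)
    (s : Sub) : K.subst s = K :=
  subst_eq_self_of_closed K (h.closed.1 a K hm) s

theorem SigValid.obj_subst (h : SigValid Sg) {c : ℕ} {A : Fam} (hm : Decl.obj c A ∈ Sg)
    (s : Sub) : A.subst s = A :=
  subst_eq_self_of_closed A (h.closed.2 c A hm) s

theorem SigValid.telescope_subst (h : SigValid Sg) {c : ℕ} {Γ : Ctx} {A : Fam}
    (hm : Decl.obj c (piCtx Γ A) ∈ Sg) (s : Sub) :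
    substCtx s Γ = Γ ∧ A.subst (liftN Γ.length s) = A :=
  piCtx_inj (length_substCtx s Γ) ((piCtx_subst s Γ A).symm.trans (h.obj_subst hm s))

/-! ## Substitution preserves typing -/

/-- A class of substitutions that are well-typed on variables and closed under extension by a
new variable. -/
structure IsTypedClass (Sg : Sig) (T : Ctx → Sub → Ctx → Prop) : Prop where
  var : ∀ {Γ' Γ : Ctx} {s : Sub} {n : ℕ} {A : Fam}, CtxValid Sg Γ' → T Γ' s Γ →
    lookup Γ n = some A → ObjTyped Sg Γ' (s n) (A.subst s)
  lift : ∀ {Γ' Γ : Ctx} {s : Sub} {A : Fam}, CtxValid Sg Γ' → T Γ' s Γ →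
    FamTyped Sg Γ' (A.subst s) .typ → T (A.subst s :: Γ') (lift s) (A :: Γ)

/-- The types of the context remain valid under the substitutions of a class. -/
def CtxStable (Sg : Sig) (T : Ctx → Sub → Ctx → Prop) : Ctx → Prop
  | [] => True
  | A :: Γ => CtxStable Sg T Γ ∧
      ∀ Γ' s, CtxValid Sg Γ' → T Γ' s Γ → FamTyped Sg Γ' (A.subst s) .typ

mutual

theorem CtxValid.stable {T : Ctx → Sub → Ctx → Prop} (hSg : SigValid Sg)
    (hT : IsTypedClass Sg T) {Γ : Ctx} : CtxValid Sg Γ → CtxStable Sg T Γ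
  | .nil => trivial
  | .cons hΓ hA => ⟨hΓ.stable hSg hT, fun Γ' s h hs => (hA.stable hSg hT).2 Γ' s h hs⟩

theorem KindValid.stable {T : Ctx → Sub → Ctx → Prop} (hSg : SigValid Sg)
    (hT : IsTypedClass Sg T) {Γ : Ctx} {K : Kind} : KindValid Sg Γ K →
    CtxStable Sg T Γ ∧ ∀ Γ' s, CtxValid Sg Γ' → T Γ' s Γ → KindValid Sg Γ' (K.subst s)
  | .typ hΓ => ⟨hΓ.stable hSg hT, fun _ _ h _ => .typ h⟩
  | .piK hK =>
    have ⟨h₁, h₂⟩ := hK.stable hSg hT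
    ⟨h₁.1, fun Γ' s h hs =>
      have hA := h₁.2 Γ' s h hs
      .piK (h₂ _ _ (.cons h hA) (hT.lift h hs hA))⟩

theorem FamTyped.stable {T : Ctx → Sub → Ctx → Prop} (hSg : SigValid Sg)
    (hT : IsTypedClass Sg T) {Γ : Ctx} {A : Fam} {K : Kind} : FamTyped Sg Γ A K →
    CtxStable Sg T Γ ∧
      ∀ Γ' s, CtxValid Sg Γ' → T Γ' s Γ → FamTyped Sg Γ' (A.subst s) (K.subst s)
  | .fcon hm hΓ => ⟨hΓ.stable hSg hT, fun _ s h _ => (hSg.fam_subst hm s).symm ▸ .fcon hm h⟩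
  | .pi hB =>
    have ⟨h₁, h₂⟩ := hB.stable hSg hT
    ⟨h₁.1, fun Γ' s h hs =>
      have hA := h₁.2 Γ' s h hs
      .pi (h₂ _ _ (.cons h hA) (hT.lift h hs hA))⟩
  | .flam hB =>
    have ⟨h₁, h₂⟩ := hB.stable hSg hT
    ⟨h₁.1, fun Γ' s h hs =>
      have hA := h₁.2 Γ' s h hs
      .flam (h₂ _ _ (.cons h hA) (hT.lift h hs hA))⟩
  | .fapp hA hM =>
    have hA := hA.stable hSg hT
    have hM := hM.stable hSg hT
    ⟨hA.1, fun Γ' s h hs => by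
      rw [inst_subst]; exact .fapp (hA.2 Γ' s h hs) (hM.2 Γ' s h hs)⟩
  | .conv hA hK hc =>
    have hA := hA.stable hSg hT
    have hK := hK.stable hSg hT
    ⟨hA.1, fun Γ' s h hs => .conv (hA.2 Γ' s h hs) (hK.2 Γ' s h hs) (hc.subst s)⟩

theorem ObjTyped.stable {T : Ctx → Sub → Ctx → Prop} (hSg : SigValid Sg)
    (hT : IsTypedClass Sg T) {Γ : Ctx} {M : Obj} {A : Fam} : ObjTyped Sg Γ M A →
    CtxStable Sg T Γ ∧
      ∀ Γ' s, CtxValid Sg Γ' → T Γ' s Γ → ObjTyped Sg Γ' (M.subst s) (A.subst s)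
  | .con hm hΓ => ⟨hΓ.stable hSg hT, fun _ s h _ => (hSg.obj_subst hm s).symm ▸ .con hm h⟩
  | .var hn hΓ => ⟨hΓ.stable hSg hT, fun _ _ h hs => hT.var h hs hn⟩
  | .lam hM =>
    have ⟨h₁, h₂⟩ := hM.stable hSg hT
    ⟨h₁.1, fun Γ' s h hs =>
      have hA := h₁.2 Γ' s h hs
      .lam (h₂ _ _ (.cons h hA) (hT.lift h hs hA))⟩
  | .app hM hN =>
    have hM := hM.stable hSg hT
    have hN := hN.stable hSg hT
    ⟨hM.1, fun Γ' s h hs => by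
      rw [inst_subst]; exact .app (hM.2 Γ' s h hs) (hN.2 Γ' s h hs)⟩
  | .conv hM hA hc =>
    have hM := hM.stable hSg hT
    have hA := hA.stable hSg hT
    ⟨hM.1, fun Γ' s h hs => .conv (hM.2 Γ' s h hs) (hA.2 Γ' s h hs) (hc.subst s)⟩

end

theorem lookup_append (Δ Γ : Ctx) (n : ℕ) :
    lookup (Δ ++ Γ) (n + Δ.length) = (lookup Γ n).map (Exp.shift Δ.length) := by
  induction Δ with
  | nil => simp [show (Exp.shift 0 : Fam → Fam) = id from funext shift_zero]
  | cons A Δ ih =>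
    change (lookup (Δ ++ Γ) (n + Δ.length)).map (Exp.shift 1) = _
    rw [ih, Option.map_map]
    congr 1
    funext B
    exact shift_shift _ _ _

/-- Renamings that preserve the types of the variables. -/
def RenTyped (Γ' : Ctx) (s : Sub) (Γ : Ctx) : Prop :=
  ∃ r : ℕ → ℕ, s = (fun n => .var (r n)) ∧
    ∀ n A, lookup Γ n = some A → lookup Γ' (r n) = some (A.rename r)

theorem isTypedClass_renTyped : IsTypedClass Sg RenTyped where
  var := by
    rintro Γ' Γ _ n A hΓ' ⟨r, rfl, hr⟩ h
    rw [← rename_eq_subst]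
    exact .var (hr n A h) hΓ'
  lift := by
    rintro Γ' Γ _ A hΓ' ⟨r, rfl, hr⟩ -
    refine ⟨liftRen r, lift_var r, fun n B h => ?_⟩
    have hs : ∀ C : Fam, (C.shift 1).rename (liftRen r) = (C.rename r).shift 1 := fun C => by
      simp only [Exp.shift, rename_rename]; rfl
    cases n with
    | zero =>
      cases h
      rw [hs, rename_eq_subst A]; rfl
    | succ n =>
      obtain ⟨C, hC, rfl⟩ := Option.map_eq_some_iff.1 h
      rw [hs]
      exact Option.map_eq_some_iff.2 ⟨_, hr n C hC, rfl⟩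

theorem renTyped_append (Δ Γ : Ctx) :
    RenTyped (Δ ++ Γ) (fun n => .var (n + Δ.length)) Γ :=
  ⟨_, rfl, fun n A h => by rw [lookup_append, h]; rfl⟩

theorem ObjTyped.weaken (hSg : SigValid Sg) {Δ Γ : Ctx} {M : Obj} {A : Fam}
    (h : ObjTyped Sg Γ M A) (hΔ : CtxValid Sg (Δ ++ Γ)) :
    ObjTyped Sg (Δ ++ Γ) (M.shift Δ.length) (A.shift Δ.length) := by
  rw [shift_eq_subst, shift_eq_subst]
  exact (h.stable hSg isTypedClass_renTyped).2 _ _ hΔ (renTyped_append Δ Γ)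

theorem SubTyped.weaken (hSg : SigValid Sg) {Δ Γ Γ' : Ctx} {s : Sub}
    (h : SubTyped Sg Γ' s Γ) (hΔ : CtxValid Sg (Δ ++ Γ')) :
    SubTyped Sg (Δ ++ Γ') (fun n => (s n).shift Δ.length) Γ := by
  induction Γ generalizing s with
  | nil => trivial
  | cons A Γ ih =>
    refine ⟨?_, ih h.2⟩
    have := h.1.weaken hSg hΔ
    rwa [Exp.shift, Exp.shift, subst_rename] at this

theorem SubTyped.lookup {Γ Γ' : Ctx} {s : Sub} (h : SubTyped Sg Γ' s Γ) {n : ℕ} {A : Fam}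
    (hn : lookup Γ n = some A) : ObjTyped Sg Γ' (s n) (A.subst s) := by
  induction Γ generalizing s n A with
  | nil => simp [LF.lookup] at hn
  | cons B Γ ih =>
    cases n with
    | zero =>
      cases hn
      rw [shift_subst]
      exact h.1
    | succ n =>
      obtain ⟨C, hC, rfl⟩ := Option.map_eq_some_iff.1 hn
      rw [shift_subst]
      exact ih h.2 hC

theorem isTypedClass_subTyped (hSg : SigValid Sg) : IsTypedClass Sg (SubTyped Sg) where
  var := fun _ h hn => h.lookup hn
  lift := by
    intro Γ' Γ s A hΓ' h hA
    have hv := CtxValid.cons hΓ' hA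
    refine ⟨?_, h.weaken hSg (Δ := [A.subst s]) hv⟩
    refine .var ?_ hv
    simp only [LF.lookup, Exp.shift, subst_rename]
    rfl

theorem ObjTyped.subst (hSg : SigValid Sg) {Γ Γ' : Ctx} {s : Sub} {M : Obj} {A : Fam}
    (h : ObjTyped Sg Γ M A) (hΓ' : CtxValid Sg Γ') (hs : SubTyped Sg Γ' s Γ) :
    ObjTyped Sg Γ' (M.subst s) (A.subst s) :=
  (h.stable hSg (isTypedClass_subTyped hSg)).2 _ _ hΓ' hs

theorem FamTyped.subst (hSg : SigValid Sg) {Γ Γ' : Ctx} {s : Sub} {A : Fam} {K : Kind}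
    (h : FamTyped Sg Γ A K) (hΓ' : CtxValid Sg Γ') (hs : SubTyped Sg Γ' s Γ) :
    FamTyped Sg Γ' (A.subst s) (K.subst s) :=
  (h.stable hSg (isTypedClass_subTyped hSg)).2 _ _ hΓ' hs

theorem CtxValid.of_append {Δ Γ : Ctx} (h : CtxValid Sg (Δ ++ Γ)) : CtxValid Sg Γ := by
  induction Δ with
  | nil => exact h
  | cons A Δ ih => cases h with | cons h _ => exact ih h

/-- Substitutions extend to the contexts that depend on their domain. -/
theorem CtxValid.substCtx (hSg : SigValid Sg) {Δ Γ Γ' : Ctx} {s : Sub}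
    (h : CtxValid Sg (Δ ++ Γ)) (hΓ' : CtxValid Sg Γ') (hs : SubTyped Sg Γ' s Γ) :
    CtxValid Sg (substCtx s Δ ++ Γ') ∧
      SubTyped Sg (LF.substCtx s Δ ++ Γ') (liftN Δ.length s) (Δ ++ Γ) := by
  induction Δ with
  | nil => exact ⟨hΓ', hs⟩
  | cons A Δ ih =>
    cases h with
    | cons h hA =>
      obtain ⟨h₁, h₂⟩ := ih h
      have hA' := hA.subst hSg h₁ h₂
      exact ⟨.cons h₁ hA', (isTypedClass_subTyped hSg).lift h₁ h₂ hA'⟩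

theorem subTyped_append {Γ' Δ Γ : Ctx} {s : Sub} : SubTyped Sg Γ' s (Δ ++ Γ) ↔
    SubTyped Sg Γ' s Δ ∧ SubTyped Sg Γ' (fun n => s (n + Δ.length)) Γ := by
  induction Δ generalizing s with
  | nil => simp [SubTyped]
  | cons A Δ ih =>
    simp only [List.cons_append, SubTyped, ih, and_assoc, List.length_cons, Nat.add_assoc]

theorem subTyped_var (hSg : SigValid Sg) {Γ : Ctx} (h : CtxValid Sg Γ) :
    SubTyped Sg Γ Exp.var Γ := by
  induction Γ with
  | nil => trivial
  | cons A Γ ih =>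
    have h' := h
    cases h' with
    | cons hΓ hA =>
      refine ⟨.var ?_ h, (ih hΓ).weaken hSg (Δ := [A]) h⟩
      simp [LF.lookup, shift_eq_subst]

theorem subTyped_weakening (hSg : SigValid Sg) {Δ Γ : Ctx} (h : CtxValid Sg (Δ ++ Γ)) :
    SubTyped Sg (Δ ++ Γ) (fun n => .var (n + Δ.length)) Γ :=
  (subTyped_append.1 (subTyped_var hSg h)).2

theorem SubTyped.comp (hSg : SigValid Sg) {Γ Γ' Γ'' : Ctx} {s t : Sub}
    (hs : SubTyped Sg Γ' s Γ) (hΓ'' : CtxValid Sg Γ'') (ht : SubTyped Sg Γ'' t Γ') :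
    SubTyped Sg Γ'' (comp s t) Γ := by
  induction Γ generalizing s with
  | nil => trivial
  | cons A Γ ih =>
    refine ⟨?_, ih hs.2⟩
    have := hs.1.subst hSg hΓ'' ht
    rwa [subst_subst] at this

theorem subTyped_substCtx {Γ' Δ : Ctx} {s t : Sub} :
    SubTyped Sg Γ' t (substCtx s Δ) ↔ SubTyped Sg Γ' (comp (liftN Δ.length s) t) Δ := by
  induction Δ generalizing t with
  | nil => rfl
  | cons A Δ ih =>
    have : (fun n => comp (liftN (Δ.length + 1) s) t (n + 1)) =
        comp (liftN Δ.length s) (fun n => t (n + 1)) := by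
      funext n
      simp [comp, liftN, lift, shift_subst]
    simp only [substCtx, SubTyped, ih, List.length_cons, this, subst_subst]
    rfl

theorem subTyped_comp_liftN (hSg : SigValid Sg) {Γ Γ' Γ'' Δ : Ctx} {s t : Sub}
    (hs : SubTyped Sg Γ' s Γ) (hΓ'' : CtxValid Sg Γ'')
    (ht : SubTyped Sg Γ'' t (substCtx s Δ ++ Γ')) :
    SubTyped Sg Γ'' (comp (liftN Δ.length s) t) (Δ ++ Γ) := by
  obtain ⟨h₁, h₂⟩ := subTyped_append.1 ht
  refine subTyped_append.2 ⟨subTyped_substCtx.1 h₁, ?_⟩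
  rw [length_substCtx] at h₂
  simp only [comp_liftN_add]
  exact hs.comp hSg hΓ'' h₂

theorem SubTyped.occurs_lt {Γ Γ' : Ctx} {s : Sub} (h : SubTyped Sg Γ' s Γ) {n m : ℕ}
    (hn : n < Γ.length) (hm : (s n).Occurs m) : m < Γ'.length := by
  obtain ⟨A, hA⟩ := exists_lookup hn
  exact (h.lookup hA).scoped.2 m hm

/-- A substitution may be replaced by a convertible one. -/
theorem SubTyped.of_conv (hSg : SigValid Sg) {Γ Γ' Δ : Ctx} {s t : Sub}
    (hΔ : CtxValid Sg (Δ ++ Γ)) (hΓ' : CtxValid Sg Γ') (hs : SubTyped Sg Γ' s (Δ ++ Γ))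
    (ht : SubTyped Sg Γ' (fun n => t (n + Δ.length)) Γ)
    (heq : ∀ n < Δ.length, t n = s n) (hconv : ∀ n < (Δ ++ Γ).length, Conv (s n) (t n)) :
    SubTyped Sg Γ' t (Δ ++ Γ) := by
  induction Δ generalizing s t with
  | nil => exact ht
  | cons A Δ ih =>
    cases hΔ with
    | cons hΔ hA =>
      have ih := ih hΔ hs.2 (by simpa [Nat.add_assoc] using ht)
        (fun n hn => heq (n + 1) (by simpa using hn))
        (fun n hn => hconv (n + 1) (by simpa using hn))
      refine ⟨?_, ih⟩
      rw [heq 0 (by simp)]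
      exact .conv hs.1 (hA.subst hSg hΓ' ih)
        (conv_subst_of_occurs A fun n hn => hconv (n + 1) (by simpa using hA.scoped.2 n hn))

theorem InstTyped.subst (hSg : SigValid Sg) {Γ Γ' Δ : Ctx} {Ms : List Obj} {s : Sub}
    (h : InstTyped Sg Γ Ms Δ) (hΓ' : CtxValid Sg Γ') (hs : SubTyped Sg Γ' s Γ) :
    InstTyped Sg Γ' (Ms.map (Exp.subst s)) (substCtx s Δ) := by
  refine ⟨by simpa [length_substCtx] using h.1, subTyped_substCtx.2 ?_⟩
  rw [← h.1, ← comp_listSub]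
  exact h.2.comp hSg hΓ' hs

theorem InstTyped.subTyped (hSg : SigValid Sg) {Γ Δ : Ctx} {Ms : List Obj}
    (h : InstTyped Sg Γ Ms Δ) (hΓ : CtxValid Sg Γ) :
    SubTyped Sg Γ (listSub Ms) (Δ ++ Γ) := by
  refine subTyped_append.2 ⟨h.2, ?_⟩
  simp only [← h.1, listSub_add]
  exact subTyped_var hSg hΓ

theorem substCtx_listSub (Ms : List Obj) (s : Sub) (Γ : Ctx) :
    substCtx s (substCtx (listSub Ms) Γ) =
      substCtx (listSub (Ms.map (Exp.subst s))) (substCtx (liftN Ms.length s) Γ) := by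
  rw [substCtx_substCtx, substCtx_substCtx, comp_listSub]

/-! ## Unifiers under substitution -/

theorem occurs_apps_con {c : ℕ} {Ms : List Obj} {n : ℕ} :
    (apps (.con c) Ms).Occurs n → ∃ M ∈ Ms, M.Occurs n := by
  have : ∀ (Ms : List Obj) (M : Obj), (apps M Ms).Occurs n →
      M.Occurs n ∨ ∃ M ∈ Ms, M.Occurs n := by
    intro Ms
    induction Ms with
    | nil => exact fun _ h => .inl h
    | cons N Ms ih =>
      intro M h
      rcases ih _ h with (h | h) | ⟨M', hM', h⟩
      · exact .inl h
      · exact .inr ⟨N, by simp, h⟩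
      · exact .inr ⟨M', by simp [hM'], h⟩
  exact fun h => (this Ms _ h).resolve_left id

theorem occurs_apps_lastVars {c k n : ℕ} (h : (apps (.con c) (lastVars k)).Occurs n) :
    n < k := by
  obtain ⟨M, hM, hn⟩ := occurs_apps_con h
  simp only [lastVars, List.mem_map, List.mem_reverse, List.mem_range] at hM
  obtain ⟨m, hm, rfl⟩ := hM
  exact hn.symm ▸ hm

theorem splitSub_lt {c k k' n : ℕ} (s : Sub) (h : n < k) : splitSub c k k' s n = s n :=
  if_pos h

theorem splitSub_self (c k k' : ℕ) (s : Sub) :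
    splitSub c k k' s k = (apps (.con c) (lastVars k)).subst s := by
  simp [splitSub]

theorem splitSub_add (c k k' n : ℕ) (s : Sub) :
    splitSub c k k' s (n + (k + 1)) = .var (n + k') := by
  simp [splitSub, show ¬ n + (k + 1) < k by omega, show n + (k + 1) ≠ k by omega]

theorem comp_splitSub (c k k' : ℕ) (s t : Sub) :
    comp (splitSub c k k' s) (liftN k' t) =
      comp (liftN (k + 1) t) (splitSub c k k' (comp s (liftN k' t))) := by
  refine sub_ext (k + 1) (fun n h => ?_) (fun n => ?_)
  · rw [comp_liftN_lt _ _ h]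
    rcases Nat.lt_succ_iff_lt_or_eq.1 h with h | rfl
    · rw [comp, splitSub_lt _ h, splitSub_lt _ h]; rfl
    · rw [comp, splitSub_self, splitSub_self, subst_subst]
  · rw [comp_liftN_add]
    simp only [comp, splitSub_add, Exp.subst, liftN_add, shift_eq_subst]

theorem shift_subst_liftN {l : Lvl} (e : Exp l) (k : ℕ) (s : Sub) :
    (e.shift k).subst (liftN k s) = (e.subst s).shift k := by
  rw [shift_subst, Exp.shift, subst_rename]
  simp only [liftN_add]
  rfl

section

variable {Γ Γ' Γc : Ctx} {A Ac : Fam} {c : ℕ} {s : Sub}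

theorem IsUnifier.of_subst (hSg : SigValid Sg)
    (hc : ∀ s, substCtx s Γc = Γc ∧ Ac.subst (liftN Γc.length s) = Ac)
    (hs : SubTyped Sg Γ' s Γ) {Γ'' : Ctx} {η : Sub}
    (h : IsUnifier Sg Γ' (A.subst s) c Γc Ac Γ'' η) :
    IsUnifier Sg Γ A c Γc Ac Γ'' (comp (liftN (Γc.length + 1) s) η) := by
  obtain ⟨hv, ht, h₁, h₂⟩ := h
  refine ⟨hv, ?_, ?_, ?_⟩
  · have := subTyped_comp_liftN hSg (Δ := Γc ++ [A]) (t := η) hs hv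
      (by simpa [substCtx_append, (hc _).1, substCtx, liftN] using ht)
    simpa using this
  · rw [← subst_subst, ← subst_subst, shift_subst_liftN, ← liftN_liftN, (hc _).2]
    exact h₁
  · rw [comp_liftN_lt _ _ (Nat.lt_succ_self _),
      subst_congr_of_occurs _ fun n hn =>
        comp_liftN_lt s η (Nat.lt_succ_of_lt (occurs_apps_lastVars hn))]
    exact h₂

theorem IsUnifier.splitSub_subst (hSg : SigValid Sg)
    (hc : ∀ s, substCtx s Γc = Γc ∧ Ac.subst (liftN Γc.length s) = Ac)
    (hΓ' : CtxValid Sg Γ') (hs : SubTyped Sg Γ' s Γ) {Γc' : Ctx} {t : Sub}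
    (h : IsUnifier Sg Γ A c Γc Ac (Γc' ++ Γ) (splitSub c Γc.length Γc'.length t)) :
    IsUnifier Sg Γ' (A.subst s) c Γc Ac (substCtx s Γc' ++ Γ')
      (splitSub c Γc.length Γc'.length (comp t (liftN Γc'.length s))) := by
  obtain ⟨hv, ht, h₁, h₂⟩ := h
  obtain ⟨hv', hl⟩ := hv.substCtx hSg hΓ' hs
  have ht' := ht.comp hSg hv' hl
  refine ⟨hv', ?_, ?_, ?_⟩
  · rw [comp_splitSub, List.append_cons] at ht'
    rw [List.append_cons]
    refine subTyped_append.2 ⟨?_, ?_⟩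
    · have := (subTyped_append.1 ht').1
      rw [show Γc.length + 1 = (Γc ++ [A]).length by simp] at this
      simpa [substCtx_append, (hc _).1, substCtx, liftN] using subTyped_substCtx.2 this
    · have := subTyped_weakening hSg hv'
      simpa [splitSub_add, length_substCtx] using this
  · have := h₁.subst (liftN Γc'.length s)
    rwa [subst_subst, subst_subst, comp_splitSub, ← subst_subst, ← subst_subst,
      shift_subst_liftN, ← liftN_liftN, (hc _).2] at this
  · rw [splitSub_self, subst_congr_of_occurs _ fun n hn =>
      splitSub_lt (c := c) (k' := Γc'.length) _ (occurs_apps_lastVars hn)]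
    exact .refl _

theorem IsMGU.splitSub_subst (hSg : SigValid Sg)
    (hc : ∀ s, substCtx s Γc = Γc ∧ Ac.subst (liftN Γc.length s) = Ac)
    (hΓ' : CtxValid Sg Γ') (hs : SubTyped Sg Γ' s Γ) {Γc' : Ctx} {t : Sub}
    (h : IsMGU Sg Γ A c Γc Ac (Γc' ++ Γ) (splitSub c Γc.length Γc'.length t)) :
    IsMGU Sg Γ' (A.subst s) c Γc Ac (substCtx s Γc' ++ Γ')
      (splitSub c Γc.length Γc'.length (comp t (liftN Γc'.length s))) := by
  refine ⟨h.1.splitSub_subst hSg hc hΓ' hs, fun Γ'' η hη => ?_⟩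
  have hη' := hη.of_subst hSg hc hs
  obtain ⟨γ, hγ, hconv⟩ := h.2 Γ'' _ hη'
  let γ' : Sub := fun n =>
    if n < Γc'.length then γ n else η (n - Γc'.length + (Γc.length + 1))
  have hγ'_lt : ∀ n < Γc'.length, γ' n = γ n := fun n hn => if_pos hn
  have hγ'_add : ∀ n, γ' (n + Γc'.length) = η (n + (Γc.length + 1)) := fun n => by simp [γ']
  have hγγ' : ∀ n < (Γc' ++ Γ).length, Conv (γ n) (comp (liftN Γc'.length s) γ' n) := by
    intro n hn
    rcases Nat.lt_or_ge n Γc'.length with h' | h'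
    · rw [comp_liftN_lt _ _ h', hγ'_lt n h']
      exact .refl _
    · obtain ⟨m, rfl⟩ := Nat.exists_eq_add_of_le' h'
      rw [comp_liftN_add]
      have := hconv (m + (Γc.length + 1)) (by simp at hn ⊢; omega)
      rw [comp_liftN_add, splitSub_add] at this
      simp only [hγ'_add]
      exact this.symm
  have htail : SubTyped Sg Γ'' (fun n => η (n + (Γc.length + 1))) Γ' := by
    have := hη.2.1
    rw [List.append_cons] at this
    simpa using (subTyped_append.1 this).2
  have hlt : ∀ n < Γc.length, Conv (η n)
      ((splitSub c Γc.length Γc'.length (comp t (liftN Γc'.length s)) n).subst γ') := by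
    intro n hn
    have h₁ := hconv n (by simp; omega)
    rw [comp_liftN_lt _ _ (Nat.lt_succ_of_lt hn)] at h₁
    refine h₁.trans ?_
    rw [splitSub_lt _ hn, splitSub_lt _ hn, comp, subst_subst]
    refine conv_subst_of_occurs _ fun m hm => hγγ' m ?_
    have := h.1.2.1.occurs_lt (n := n) (m := m) (by simp; omega)
    exact this (by rwa [splitSub_lt _ hn])
  refine ⟨γ', subTyped_append.2 ⟨?_, ?_⟩, fun n hn => ?_⟩
  · refine subTyped_substCtx.2 (subTyped_append.1 (hγ.of_conv hSg h.1.1 hη.1 ?_ ?_ hγγ')).1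
    · simp only [comp_liftN_add, hγ'_add]
      exact hs.comp hSg hη.1 htail
    · intro n hn
      rw [comp_liftN_lt _ _ hn, hγ'_lt n hn]
  · simpa only [length_substCtx, hγ'_add] using htail
  · rcases Nat.lt_trichotomy n Γc.length with h' | rfl | h'
    · exact hlt n h'
    · refine hη.2.2.2.trans ?_
      rw [splitSub_self, subst_subst]
      refine conv_subst_of_occurs _ fun m hm => ?_
      have hm := occurs_apps_lastVars hm
      have := hlt m hm
      rwa [splitSub_lt _ hm] at this
    · obtain ⟨m, rfl⟩ := Nat.exists_eq_add_of_le' (Nat.succ_le_of_lt h')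
      rw [Nat.succ_eq_add_one, splitSub_add]
      simp only [Exp.subst, hγ'_add]
      exact .refl _

end

end LF

namespace M2

open LF

variable {Sg : Sig}

theorem Formula.subst_subst (F : Formula) (s t : Sub) :
    (F.subst s).subst t = F.subst (comp s t) := by
  simp [Formula.subst, substCtx_substCtx, length_substCtx, liftN_comp]

theorem Formula.subst_var (F : Formula) : F.subst Exp.var = F := by
  simp [Formula.subst, liftN_var, substCtx_var]

theorem comp_weakening_liftN (k : ℕ) (s : Sub) :
    comp (fun n => .var (n + k)) (liftN k s) = comp s (fun n => .var (n + k)) := by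
  funext n
  simp [comp, Exp.subst, liftN_add, shift_eq_subst]

theorem Formula.shift_subst_liftN (F : Formula) (k : ℕ) (s : Sub) :
    (F.shift k).subst (liftN k s) = (F.subst s).shift k := by
  simp only [Formula.shift, Formula.subst_subst, comp_weakening_liftN]

theorem map_subst_subst (Δ : List Formula) (s t : Sub) :
    (Δ.map (Formula.subst s)).map (Formula.subst t) = Δ.map (Formula.subst (comp s t)) := by
  simp [Formula.subst_subst]

theorem map_shift_subst_liftN (Δ : List Formula) (k : ℕ) (s : Sub) :
    (Δ.map (Formula.shift k)).map (Formula.subst (liftN k s)) =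
      (Δ.map (Formula.subst s)).map (Formula.shift k) := by
  simp [Formula.shift_subst_liftN]

theorem Formula.Valid.subst (hSg : SigValid Sg) {Γ Γ' : Ctx} {F : Formula} {s : Sub}
    (h : F.Valid Sg Γ) (hΓ' : CtxValid Sg Γ') (hs : SubTyped Sg Γ' s Γ) :
    (F.subst s).Valid Sg Γ' := by
  unfold Formula.Valid at h
  rw [← List.append_assoc] at h
  have := (h.substCtx hSg hΓ' hs).1
  rwa [substCtx_append, List.append_assoc] at this

theorem SeqValid.subst (hSg : SigValid Sg) {Γ Γ' : Ctx} {Δ : List Formula} {F : Formula}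
    {s : Sub} (h : SeqValid Sg Γ Δ F) (hΓ' : CtxValid Sg Γ') (hs : SubTyped Sg Γ' s Γ) :
    SeqValid Sg Γ' (Δ.map (Formula.subst s)) (F.subst s) := by
  refine ⟨hΓ', fun G hG => ?_, h.2.2.subst hSg hΓ' hs⟩
  obtain ⟨G', hG', rfl⟩ := List.mem_map.1 hG
  exact (h.2.1 G' hG').subst hSg hΓ' hs

/-- The instance of a sequent under a substitution for the first part of its context. -/
theorem SeqValid.substCtx (hSg : SigValid Sg) {Γ₁ Γ₂ Γ' : Ctx} {Δ : List Formula}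
    {F : Formula} {s : Sub} (h : SeqValid Sg (Γ₂ ++ Γ₁) Δ F) (hΓ' : CtxValid Sg Γ')
    (hs : SubTyped Sg Γ' s Γ₁) :
    SeqValid Sg (substCtx s Γ₂ ++ Γ') (Δ.map (Formula.subst (liftN Γ₂.length s)))
      (F.subst (liftN Γ₂.length s)) :=
  have hv := h.1.substCtx hSg hΓ' hs
  h.subst hSg hv.1 hv.2

theorem isPermutation_id (Γ : Ctx) : IsPermutation id Γ Γ where
  length_eq := rfl
  maps_to _ h := h
  inj _ _ _ _ h := h
  types _ A h := ⟨A, h, by rw [rename_id]; exact .refl _⟩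

theorem IsPermutation.subTyped (hSg : SigValid Sg) {r : ℕ → ℕ} {Γ Γ' : Ctx}
    (h : IsPermutation r Γ Γ') (hΓ : CtxValid Sg Γ) (hΓ' : CtxValid Sg Γ') :
    SubTyped Sg Γ' (fun n => .var (r n)) Γ := by
  have ht := h.types
  clear h
  induction Γ generalizing r with
  | nil => trivial
  | cons A Γ ih =>
    cases hΓ with
    | cons hΓ hA =>
      have ih := ih (r := fun n => r (n + 1)) hΓ fun n B hB => by
        obtain ⟨B', hB', hc⟩ := ht (n + 1) _ (Option.map_eq_some_iff.2 ⟨B, hB, rfl⟩)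
        exact ⟨B', hB', by rwa [Exp.shift, rename_rename] at hc⟩
      refine ⟨?_, ih⟩
      obtain ⟨A', hA', hc⟩ := ht 0 _ rfl
      rw [Exp.shift, rename_rename, rename_eq_subst] at hc
      exact .conv (.var hA' hΓ') (hA.subst hSg hΓ' ih) hc

/-- The substitution of a case, restricted to the variables other than those of the constant. -/
theorem comp_splitSub_tail (c k k' : ℕ) (t s : Sub) :
    comp (fun n => splitSub c k k' t (n + k)) (liftN k' s) =
      comp (liftN 1 s) (fun n => splitSub c k k' (comp t (liftN k' s)) (n + k)) := by
  funext n
  have := congrFun (comp_splitSub c k k' t s) (n + k)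
  rw [← liftN_liftN, comp_liftN_add] at this
  exact this

/-- The generated proofs are stable under instantiation of the input context. -/
theorem Gen.instantiate (hSg : SigValid Sg) {K : Clause} {p : Phase} {Γi Γo : Ctx}
    {Δ : List Formula} {F : Formula} (h : Gen Sg K p Γi Γo Δ F) :
    SeqValid Sg (Γo ++ Γi) Δ F → ∀ (Γ' : Ctx) (s : Sub), CtxValid Sg Γ' →
      SubTyped Sg Γ' s Γi →
      Derivable Sg (substCtx s Γo ++ Γ') (Δ.map (Formula.subst (liftN Γo.length s)))
        (F.subst (liftN Γo.length s)) := by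
  refine Gen.rec (Sg := Sg) (K := K)
    (motive_1 := fun _ Γi Γo Δ F _ => SeqValid Sg (Γo ++ Γi) Δ F →
      ∀ (Γ' : Ctx) (s : Sub), CtxValid Sg Γ' → SubTyped Sg Γ' s Γi →
        Derivable Sg (substCtx s Γo ++ Γ') (Δ.map (Formula.subst (liftN Γo.length s)))
          (F.subst (liftN Γo.length s)))
    (motive_2 := fun _ Γi Γ₁ A Γ₂ Δ F S _ => (∀ d ∈ S, d ∈ Sg) →
      SeqValid Sg (Γ₂ ++ A :: (Γ₁ ++ Γi)) Δ F →
      ∀ (Γ' : Ctx) (s : Sub), CtxValid Sg Γ' → SubTyped Sg Γ' s Γi →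
        CaseDerivable Sg (substCtx s Γ₁ ++ Γ') (A.subst (liftN Γ₁.length s))
          (substCtx (liftN 1 (liftN Γ₁.length s)) Γ₂)
          (Δ.map (Formula.subst (liftN Γ₂.length (liftN 1 (liftN Γ₁.length s)))))
          (F.subst (liftN Γ₂.length (liftN 1 (liftN Γ₁.length s)))) S)
    ?base ?call ?results ?split ?covered ?empty ?fam ?nonuni ?uni h
  case base =>
    intro Δ hw _ Γ' s hΓ' hs
    exact .exR _ _ (hw.subst hSg hΓ' hs)
  case call =>
    intro i Δ _ hmem hMs _ ih hv Γ' s hΓ' hs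
    have hprem : Formula.Valid Sg (K.ctx i) ⟨[], K.premTel i⟩ := by
      have h := hv.2.1 _ hmem
      exact (CtxValid.substCtx hSg h hv.1 (hMs.subTyped hSg hv.1)).1
    have ih := ih ⟨hv.1, List.forall_mem_cons.2 ⟨hprem, hv.2.1⟩, hv.2.2⟩ Γ' s hΓ' hs
    refine .allL _ _ _ (List.mem_map.2 ⟨_, hmem, rfl⟩) (hMs.subst hSg hΓ' hs) ?_
    have : K.inCtx.length = (K.read i (K.premise i).ins).length := hMs.1.symm
    simp only [Clause.indHyp, this]
    rw [← substCtx_listSub]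
    exact ih
  case results =>
    intro i Δ hmem _ ih hv Γ' s hΓ' hs
    have hprem : CtxValid Sg (K.premTel i ++ K.ctx i) := hv.2.1 _ hmem
    have ih := ih (hv.subst hSg hprem (subTyped_weakening hSg hprem)) Γ' s hΓ' hs
    refine .exL _ (List.mem_map.2 ⟨_, hmem, rfl⟩) ?_
    rw [map_shift_subst_liftN, Formula.shift_subst_liftN] at ih
    simpa [length_substCtx, substCtx, liftN] using ih
  case split =>
    intro i Γi Γ₁ Γ₂ A Δ F hA _ _ ih hv Γ' s hΓ' hs
    have hc : substCtx s (Γ₂ ++ A :: Γ₁) ++ Γ' =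
        substCtx (liftN 1 (liftN Γ₁.length s)) Γ₂ ++
          A.subst (liftN Γ₁.length s) :: (substCtx s Γ₁ ++ Γ') := by
      simp [substCtx_append, substCtx, liftN]
    have hl : liftN (Γ₂ ++ A :: Γ₁).length s =
        liftN Γ₂.length (liftN 1 (liftN Γ₁.length s)) := by
      simp [liftN_liftN, Nat.add_comm 1]
    have hv' := hv.substCtx hSg hΓ' hs
    rw [hc] at hv' ⊢
    rw [hl]
    have ih := ih (fun _ h => h) (by simpa using hv) Γ' s hΓ' hs
    refine .case _ _ _ id (isPermutation_id _) hv'.1 (hA.subst _) ?_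
    simpa only [id, Formula.subst_var, map_subst_subst, comp_var] using ih
  case covered =>
    intro i Γo Δ r hr _ _ hv' _ ih hv Γ' s hΓ' hs
    have hc := hv.1.substCtx hSg hΓ' hs
    have := ih hv' _ _ hc.1 ((hr.subTyped hSg hv'.1 hv.1).comp hSg hc.1 hc.2)
    rw [map_subst_subst, Formula.subst_subst]
    exact this
  case empty => exact fun _ _ _ _ _ _ => .empty
  case fam =>
    intro i Γi Γ₁ A Γ₂ Δ F S a L _ ih hS hv Γ' s hΓ' hs
    exact .fam a L (ih (fun d hd => hS d (List.mem_cons_of_mem _ hd)) hv Γ' s hΓ' hs)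
  case nonuni =>
    intro i Γi Γ₁ A Γ₂ Δ F S c Γc Ac hAc _ hno _ ih hS hv Γ' s hΓ' hs
    have hv₁ := (hv.1.of_append (Δ := Γ₂)).of_append (Δ := [A])
    refine .nonuni c Γc Ac hAc ?_
      (ih (fun d hd => hS d (List.mem_cons_of_mem _ hd)) hv Γ' s hΓ' hs)
    rintro ⟨Γ'', η, hη⟩
    exact hno ⟨Γ'', _, hη.of_subst hSg (hSg.telescope_subst (hS _ List.mem_cons_self))
      (hv₁.substCtx hSg hΓ' hs).2⟩
  case uni =>
    intro i Γi Γ₁ A Γ₂ Δ F S c Γc Ac Γc' t θ hAc _ hθ hmgu _ _ ih ih' hS hv Γ' s hΓ' hs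
    subst hθ
    have hv₁ := (hv.1.of_append (Δ := Γ₂)).of_append (Δ := [A])
    obtain ⟨hv₁', hs₁⟩ := hv₁.substCtx hSg hΓ' hs
    have hmgu' := hmgu.splitSub_subst hSg (hSg.telescope_subst (hS _ List.mem_cons_self))
      hv₁' hs₁
    refine .uni c Γc Ac _ _ hAc hmgu' ?_
      (ih' (fun d hd => hS d (List.mem_cons_of_mem _ hd)) hv Γ' s hΓ' hs)
    have hθ := (subTyped_append.1 hmgu.1.2.1).2
    have ih := ih (by simpa using hv.substCtx hSg hmgu.1.1 hθ) Γ' s hΓ' hs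
    have hc := comp_splitSub_tail c Γc.length Γc'.length t (liftN Γ₁.length s)
    have hlen : (substCtx (fun n => splitSub c Γc.length Γc'.length t (n + Γc.length)) Γ₂ ++
        (Γc' ++ Γ₁)).length = Γ₂.length + (Γc'.length + Γ₁.length) := by
      simp [length_substCtx]
    rw [hlen, map_subst_subst, Formula.subst_subst, ← liftN_liftN, ← liftN_liftN,
      ← liftN_comp, hc, substCtx_append, substCtx_append, List.length_append, ← liftN_liftN,
      substCtx_substCtx, hc] at ih
    rw [map_subst_subst, Formula.subst_subst, length_substCtx, ← liftN_comp, substCtx_substCtx]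
    simpa using ih

end M2

theorem mainTheorem2 (Sg : LF.Sig) (hSg : LF.SigValid Sg)
    (K : M2.Clause) (hK : K.InSig Sg)
    (Γ₁ Γ₂ : LF.Ctx) (Δ : List M2.Formula) (F : M2.Formula)
    (hS : M2.SeqValid Sg (Γ₂ ++ Γ₁) Δ F)
    (hD : M2.GeneratedProof Sg K Γ₁ Γ₂ Δ F)
    (Γ₁' : LF.Ctx) (hΓ : LF.CtxValid Sg Γ₁')
    (σ₁ : LF.Sub) (hσ : LF.SubTyped Sg Γ₁' σ₁ Γ₁) :
    M2.SeqValid Sg (LF.substCtx σ₁ Γ₂ ++ Γ₁')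
      (Δ.map (M2.Formula.subst (LF.liftN Γ₂.length σ₁)))
      (F.subst (LF.liftN Γ₂.length σ₁)) ∧
    M2.Derivable Sg (LF.substCtx σ₁ Γ₂ ++ Γ₁')
      (Δ.map (M2.Formula.subst (LF.liftN Γ₂.length σ₁)))
      (F.subst (LF.liftN Γ₂.length σ₁)) := by
  refine ⟨hS.substCtx hSg hΓ hσ, ?_⟩
  obtain ⟨p, Γr, Γo, rfl, hD⟩ := hD
  rw [List.append_assoc] at hS
  obtain ⟨hv, hs⟩ := (hS.1.of_append (Δ := Γo)).substCtx hSg hΓ hσ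
  have := hD.instantiate hSg hS _ _ hv hs
  rwa [LF.liftN_liftN, ← List.length_append, ← List.append_assoc, ← LF.substCtx_append] at this
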